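/- Let $H_1, H_2$ be infinite-dimensional complex Hilbert spaces and let $1\le p,q\le 2$. For a Hilbert space $H$ let $S_p(H)=\{T\in B(H): \|T\|_p<\infty\}$ with $\|T\|_p=\operatorname{Tr}(|T|^p)^{1/p}$ be the Banach algebra of Schatten $p$-class operators, with composition as product. Let $S_p(H_1)\otimes^\gamma S_q(H_2)$ be the projective tensor product, i.e. the Banach algebra obtained by completing the algebraic tensor product, with product $(x_1\otimes y_1)(x_2\otimes y_2)=x_1x_2\otimes y_1y_2$, in the norm $$\|u\|_\gamma=\inf\Big\{\sum_{i=1}^n\|x_i\|_p\,\|y_i\|_q : u=\sum_{i=1}^n x_i\otimes y_i\Big\}.$$ Then $S_p(H_1)\otimes^\gamma S_q(H_2)$ is not Arens regular: the two Arens products $\Box$ and $\diamond$ on its bidual do not coincide. Here, for a normed algebra $A$, $\omega\in A^*$, $a,b\in A$ and $f,g\in A^{**}$, one sets $\omega_a(b)=\omega(ab)$, ${}_a\omega(b)=\omega(ba)$, $\omega_f(a)=f({}_a\omega)$, ${}_f\omega(a)=f(\omega_a)$, and $(f\,\Box\, g)(\omega)=f({}_g\omega)$, $(f\diamond g)(\omega)=g(\omega_f)$.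 -/

import Mathlib

namespace Schatten
open scoped ENNReal

universe u
variable {H : Type u} [NormedAddCommGroup H] [InnerProductSpace ℂ H] [CompleteSpace H]

/-- The canonical trace `Tr A = ∑ ⟨A e, e⟩ ∈ [0, ∞]` of a positive operator, computed in an
orthonormal basis; it is independent of the basis by `trace_eq`. -/
noncomputable def trace (A : H →L[ℂ] H) : ℝ≥0∞ :=
  ∑' e : (exists_hilbertBasis ℂ H).choose, ENNReal.ofReal (RCLike.re (inner ℂ (A e) (e : H)))

theorem parseval {ι : Type*} (b : HilbertBasis ι ℂ H) (x : H) :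
    ∑' i, ‖inner ℂ (b i) x‖ₑ ^ 2 = ‖x‖ₑ ^ 2 := by
  have h := b.hasSum_inner_mul_inner x x
  have h2 : HasSum (fun i => ‖inner ℂ (b i) x‖ ^ 2) (‖x‖ ^ 2) := by
    have := Complex.hasSum_re h
    rw [inner_self_eq_norm_sq_to_K] at this
    convert this using 1
    · ext i
      rw [← inner_conj_symm x (b i), ← Complex.normSq_eq_conj_mul_self, Complex.ofReal_re, Complex.normSq_eq_norm_sq]
    · norm_cast
  have h3 := ENNReal.ofReal_tsum_of_nonneg (fun i => by positivity) h2.summable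
  rw [h2.tsum_eq] at h3
  simpa [ENNReal.ofReal_pow] using h3.symm

theorem hs_swap {ι κ : Type*} (b : HilbertBasis ι ℂ H) (c : HilbertBasis κ ℂ H) (D : H →L[ℂ] H) :
    ∑' i, ‖D (b i)‖ₑ ^ 2 = ∑' j, ‖(star D) (c j)‖ₑ ^ 2 := by
  simp_rw [← parseval c (D _), ← parseval b ((star D) _)]
  rw [ENNReal.tsum_comm]
  refine tsum_congr fun j => tsum_congr fun i => ?_
  rw [ContinuousLinearMap.star_eq_adjoint, ContinuousLinearMap.adjoint_inner_right,
    ← inner_conj_symm]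
  simp only [← ofReal_norm, RCLike.norm_conj]

theorem hs_bound {ι : Type*} (b : HilbertBasis ι ℂ H) (D : H →L[ℂ] H) (x : H) :
    ‖D x‖ₑ ^ 2 ≤ (∑' i, ‖D (b i)‖ₑ ^ 2) * ‖x‖ₑ ^ 2 := by
  rw [← parseval b (D x), hs_swap b b, ← ENNReal.tsum_mul_right]
  refine ENNReal.tsum_le_tsum fun i => ?_
  rw [← mul_pow]
  gcongr
  rw [← ContinuousLinearMap.adjoint_inner_left, ContinuousLinearMap.star_eq_adjoint,
    ← ofReal_norm, ← ofReal_norm, ← ofReal_norm, ← ENNReal.ofReal_mul (norm_nonneg _)]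
  exact ENNReal.ofReal_le_ofReal (norm_inner_le_norm _ _)

theorem hs_compact {ι : Type*} (b : HilbertBasis ι ℂ H) (D : H →L[ℂ] H)
    (hD : ∑' i, ‖D (b i)‖ₑ ^ 2 ≠ ∞) : IsCompactOperator D := by
  classical
  let T : Finset ι → H →L[ℂ] H := fun s =>
    ∑ i ∈ s, (ContinuousLinearMap.toSpanSingleton ℂ (D (b i))) ∘L (innerSL ℂ (b i))
  have hTc : ∀ s, IsCompactOperator (T s) := by
    intro s
    refine Submodule.sum_mem (compactOperator (RingHom.id ℂ) H H) (t := s) (f := fun i =>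
      (((ContinuousLinearMap.toSpanSingleton ℂ (D (b i))) ∘L (innerSL ℂ (b i)) : H →L[ℂ] H)) ) ?_
    intro i _
    have h1 : IsCompactOperator (innerSL ℂ (b i)) :=
      isCompactOperator_of_locallyCompactSpace_dom (innerSL ℂ (b i))
    exact h1.clm_comp (ContinuousLinearMap.toSpanSingleton ℂ (D (b i)))
  have hTb : ∀ s i, T s (b i) = if i ∈ s then D (b i) else 0 := by
    intro s i
    simp only [T, sum_apply, ContinuousLinearMap.comp_apply,
      innerSL_apply_apply, ContinuousLinearMap.toSpanSingleton_apply]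
    simp_rw [orthonormal_iff_ite.mp b.orthonormal]
    simp
  have hle : ∀ s, ‖T s - D‖ₑ ^ 2 ≤ ∑' i : {i // i ∉ s}, ‖D (b i)‖ₑ ^ 2 := by
    intro s
    set C := ∑' i : {i // i ∉ s}, ‖D (b i)‖ₑ ^ 2 with hC
    have h1 : ∑' i, ‖(T s - D) (b i)‖ₑ ^ 2 = C := by
      rw [hC, ← tsum_subtype_eq_of_support_subset (s := {i | i ∉ s})]
      · refine tsum_congr fun i => ?_
        have : (i : ι) ∉ s := i.2
        simp [hTb, this]
      · intro i hi his
        simp [hTb, show i ∈ s from his] at hi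
    have hCf : C ≠ ∞ := ne_top_of_le_ne_top hD (ENNReal.tsum_comp_le_tsum_of_injective
      Subtype.val_injective (fun i => ‖D (b i)‖ₑ ^ 2))
    have h2 : ‖T s - D‖ ≤ √ C.toReal := by
      refine ContinuousLinearMap.opNorm_le_bound _ (Real.sqrt_nonneg _) fun x => ?_
      have := hs_bound b (T s - D) x
      rw [h1] at this
      have h3 := ENNReal.toReal_mono (by finiteness) this
      simp only [ENNReal.toReal_pow, toReal_enorm, ENNReal.toReal_mul] at h3
      refine le_of_sq_le_sq ?_ (by positivity)
      rwa [mul_pow, Real.sq_sqrt (by positivity)]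
    rw [← ofReal_norm, ← ENNReal.ofReal_pow (norm_nonneg _), ENNReal.ofReal_le_iff_le_toReal hCf]
    calc ‖T s - D‖ ^ 2 ≤ (√ C.toReal) ^ 2 := by gcongr
      _ = _ := Real.sq_sqrt (by positivity)
  have hTt : Filter.Tendsto T Filter.atTop (nhds D) := by
    rw [tendsto_iff_edist_tendsto_0]
    have h0 := ENNReal.tendsto_tsum_compl_atTop_zero hD
    have h1 : Filter.Tendsto (fun s => ‖T s - D‖ₑ ^ 2) Filter.atTop (nhds 0) :=
      tendsto_of_tendsto_of_tendsto_of_le_of_le tendsto_const_nhds h0 (fun _ => zero_le) hle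
    have h2 := (ENNReal.continuous_rpow_const (y := 1 / 2)).tendsto 0 |>.comp h1
    simp only [one_div, inv_pos, Nat.ofNat_pos, ENNReal.zero_rpow_of_pos] at h2
    refine h2.congr fun s => ?_
    rw [Function.comp_apply, edist_eq_enorm_sub, ← ENNReal.rpow_natCast, ← ENNReal.rpow_mul]
    simp
  exact isCompactOperator_of_tendsto hTt (Filter.Eventually.of_forall hTc)

theorem cfc_eigen (A : H →L[ℂ] H) (hA : IsSelfAdjoint A) (f : ℝ → ℝ)
    (hf : ContinuousOn f (spectrum ℝ A)) (l : ℝ) (v : H) (hv0 : v ≠ 0) (hv : A v = (l : ℂ) • v) :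
    cfc f A v = (f l : ℂ) • v := by
  have hl : l ∈ spectrum ℝ A := by
    intro hu
    obtain ⟨u, hu⟩ := hu
    have h1 : (u : H →L[ℂ] H) v = 0 := by
      rw [hu]; simp [hv, Algebra.algebraMap_eq_smul_one]
    have h2 : ((↑u⁻¹ : H →L[ℂ] H) * (u : H →L[ℂ] H)) v = v := by simp
    rw [mul_apply_eq_comp, h1, map_zero] at h2
    exact hv0 h2.symm
  have key : ∀ g : C(spectrum ℝ A, ℝ), cfcHom (a := A) hA g v = (g ⟨l, hl⟩ : ℂ) • v := by
    intro g
    induction g using ContinuousMap.induction_on_of_compact with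
    | const r =>
      have : (ContinuousMap.const (spectrum ℝ A) r) = algebraMap ℝ _ r := rfl
      rw [this, AlgHomClass.commutes]
      simp [Algebra.algebraMap_eq_smul_one]
    | id =>
      rw [cfcHom_id]; simpa using hv
    | star_id =>
      have : star (ContinuousMap.restrict (spectrum ℝ A) (ContinuousMap.id ℝ)) =
        (ContinuousMap.restrict (spectrum ℝ A) (ContinuousMap.id ℝ)) := by ext; simp
      rw [this, cfcHom_id]; simpa using hv
    | add f g hf hg => simp [hf, hg, add_smul]
    | mul f g hf hg => 
      rw [map_mul, ContinuousLinearMap.mul_def, ContinuousLinearMap.comp_apply, hg, map_smul, hf,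
        smul_smul, ContinuousMap.mul_apply]
      push_cast
      rw [mul_comm]
    | frequently f h =>
      refine h.mem_of_closed (isClosed_eq ?_ ?_)
      · have := cfcHom_continuous (R := ℝ) hA
        fun_prop
      · fun_prop
  rw [cfc_apply f A hA hf, key]
  simp

open scoped ComplexOrder in
/-- Spectral theorem: a positive compact operator has an orthonormal basis of eigenvectors. -/
theorem eigenbasis (B : H →L[ℂ] H) (hB : IsCompactOperator B) (hs : 0 ≤ B) :
    ∃ (ι : Type u) (b : HilbertBasis ι ℂ H) (l : ι → NNReal), ∀ i, B (b i) = ((l i : ℝ) : ℂ) • b i := by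
  classical
  have hpos : B.IsPositive := (ContinuousLinearMap.nonneg_iff_isPositive B).mp hs
  have hsym : B.IsSymmetric := hpos.isSymmetric
  let E : ℂ → Submodule ℂ H := fun μ => Module.End.eigenspace (B : Module.End ℂ H) μ
  have hcl : ∀ μ, IsClosed (E μ : Set H) := by
    intro μ
    have : (E μ : Set H) = {x | B x = μ • x} := by
      ext x; simp [E]
    rw [this]; exact isClosed_eq (by fun_prop) (by fun_prop)
  have : ∀ μ, CompleteSpace (E μ) := fun μ => (hcl μ).completeSpace_coe
  choose w c hc using fun μ => exists_hilbertBasis ℂ (E μ)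
  let v : (Σ μ, w μ) → H := fun a => ((c a.1 a.2 : E a.1) : H)
  have hv : Orthonormal ℂ v :=
    hsym.orthogonalFamily_eigenspaces.orthonormal_sigma_orthonormal (fun μ => (c μ).orthonormal)
  have hbot : (Submodule.span ℂ (Set.range v))ᗮ = ⊥ := by
    rw [eq_bot_iff, ← ContinuousLinearMap.orthogonalComplement_iSup_eigenspaces_eq_bot hB hsym]
    intro x hx
    rw [Submodule.mem_orthogonal] at hx ⊢
    intro u hu
    refine Submodule.iSup_induction (p := E) (motive := fun u => inner ℂ u x = 0) hu ?_ ?_ ?_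
    · intro μ y hy
      have hd := (c μ).dense_span
      have h1 : (⟨y, hy⟩ : E μ) ∈ (Submodule.span ℂ (Set.range (c μ))).topologicalClosure := by
        rw [hd]; trivial
      have h2 : closure (Submodule.span ℂ (Set.range (c μ)) : Set (E μ)) ⊆
          {z : E μ | inner ℂ (z : H) x = 0} := by
        refine closure_minimal ?_ (isClosed_eq (by fun_prop) (by fun_prop))
        intro z hz
        refine Submodule.span_induction (p := fun (z : E μ) _ => inner ℂ (z : H) x = 0) ?_ ?_ ?_ ?_ hz
        · rintro _ ⟨i, rfl⟩
          exact hx _ (Submodule.subset_span ⟨⟨μ, i⟩, rfl⟩)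
        · simp
        · intro a b _ _ ha hb; simp only [Submodule.coe_add, inner_add_left, ha, hb, add_zero]
        · intro a b _ hb; simp [hb]
      exact h2 h1
    · simp
    · intro a b ha hb; simp [inner_add_left, ha, hb]
  let b := HilbertBasis.mkOfOrthogonalEqBot hv hbot
  have hb : ∀ a, b a = v a := fun a => by simp [b]
  have hBv : ∀ a, B (v a) = a.1 • v a := fun a => by
    exact Module.End.mem_eigenspace_iff.mp (c a.1 a.2).2
  have hval : ∀ a, ∃ r : NNReal, B (b a) = ((r : ℝ) : ℂ) • b a := by
    intro a
    have h0 : 0 ≤ inner ℂ (v a) (B (v a)) := hpos.inner_nonneg_right _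
    have hn : ‖v a‖ = 1 := hv.1 a
    rw [hBv, inner_smul_right, inner_self_eq_norm_sq_to_K, hn] at h0
    have h1 : (0:ℂ) ≤ a.1 := by simpa using h0
    refine ⟨⟨a.1.re, (Complex.nonneg_iff.mp h1).1⟩, ?_⟩
    rw [hb, hBv]
    congr 1
    apply Complex.ext
    · rfl
    · simpa using (Complex.nonneg_iff.mp h1).2.symm
  choose l hl using hval
  exact ⟨_, b, l, hl⟩

theorem tsum_eq_hs {ι : Type*} (b : HilbertBasis ι ℂ H) (D : H →L[ℂ] H) (hD : 0 ≤ D) :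
    ∑' i, ENNReal.ofReal (RCLike.re (inner ℂ ((D * D) (b i)) (b i))) = ∑' i, ‖D (b i)‖ₑ ^ 2 := by
  refine tsum_congr fun i => ?_
  have hs : D.adjoint = D := (IsSelfAdjoint.of_nonneg hD).star_eq
  have h1 : inner ℂ ((D * D) (b i)) (b i) = inner ℂ (D (b i)) (D (b i)) := by
    rw [mul_apply_eq_comp]
    conv_lhs => rw [← hs, ContinuousLinearMap.adjoint_inner_left, hs]
  rw [h1, inner_self_eq_norm_sq, ENNReal.ofReal_pow (norm_nonneg _), ofReal_norm]

theorem trace_mul_self {ι : Type*} (b : HilbertBasis ι ℂ H) (D : H →L[ℂ] H) (hD : 0 ≤ D) :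
    trace (D * D) = ∑' i, ‖D (b i)‖ₑ ^ 2 := by
  obtain ⟨c, hc⟩ := (exists_hilbertBasis ℂ H).choose_spec
  have h : trace (D * D) =
      ∑' i, ENNReal.ofReal (RCLike.re (inner ℂ ((D * D) (c i)) (c i))) := by
    simp only [trace, hc]
  rw [h, tsum_eq_hs c D hD, hs_swap c b, (IsSelfAdjoint.of_nonneg hD).star_eq]

/-- The trace of a positive operator does not depend on the orthonormal basis. -/
theorem trace_eq {ι : Type*} (b : HilbertBasis ι ℂ H) (A : H →L[ℂ] H) (hA : 0 ≤ A) :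
    trace A = ∑' i, ENNReal.ofReal (RCLike.re (inner ℂ (A (b i)) (b i))) := by
  have h := CFC.sqrt_mul_sqrt_self A hA
  have h1 := trace_mul_self b (CFC.sqrt A) (CFC.sqrt_nonneg A)
  have h2 := tsum_eq_hs b (CFC.sqrt A) (CFC.sqrt_nonneg A)
  rw [h] at h1 h2
  rw [h1, h2]

theorem trace_mono {A B : H →L[ℂ] H} (hA : 0 ≤ A) (hAB : A ≤ B) : trace A ≤ trace B := by
  obtain ⟨w, c, hc⟩ := exists_hilbertBasis ℂ H
  rw [trace_eq c A hA, trace_eq c B (hA.trans hAB)]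
  refine ENNReal.tsum_le_tsum fun i => ENNReal.ofReal_le_ofReal ?_
  have h := (ContinuousLinearMap.nonneg_iff_isPositive (B - A)).mp (sub_nonneg.mpr hAB)
  have h2 := h.re_inner_nonneg_left (c i)
  simpa [inner_sub_left] using h2

/-- The Schatten `p`-norm `‖T‖_p = Tr(|T|^p)^(1/p)`, with value `∞` when the trace diverges. -/
noncomputable def schattenENorm (p : ℝ) (T : H →L[ℂ] H) : ℝ≥0∞ :=
  trace (CFC.abs T ^ p) ^ (1 / p)

theorem rpow_add' (a : H →L[ℂ] H) {x y : ℝ} (hx : 0 ≤ x) (hy : 0 ≤ y)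
    (hxy : x + y ≠ 0) : a ^ (x + y) = a ^ x * a ^ y := by
  rw [CFC.rpow_def, CFC.rpow_def, CFC.rpow_def, ← cfc_mul _ _ a
    (NNReal.continuous_rpow_const hx).continuousOn (NNReal.continuous_rpow_const hy).continuousOn]
  exact cfc_congr fun z _ => NNReal.rpow_add' hxy z

theorem rpow_smul' (a : H →L[ℂ] H) (ha : 0 ≤ a) (r : NNReal) {x : ℝ} (hx : 0 ≤ x) :
    (r • a) ^ x = (r ^ x) • a ^ x := by
  rw [CFC.rpow_def, CFC.rpow_def, ← cfc_const_mul _ _ a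
    (NNReal.continuous_rpow_const hx).continuousOn,
    ← cfc_comp_const_mul r _ a (NNReal.continuous_rpow_const hx).continuousOn]
  exact cfc_congr fun z _ => NNReal.mul_rpow

theorem trace_smul (r : NNReal) (A : H →L[ℂ] H) : trace (r • A) = r * trace A := by
  rw [trace, trace, ← ENNReal.tsum_mul_left]
  refine tsum_congr fun e => ?_
  have : (r • A) (e : H) = ((r : ℝ) : ℂ) • A e := by
    rfl
  rw [this, inner_smul_left, ← ENNReal.ofReal_coe_nnreal, ← ENNReal.ofReal_mul r.coe_nonneg,
    Complex.conj_ofReal]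
  simp

theorem abs_rpow (R : H →L[ℂ] H) {p : ℝ} (hp : 0 < p) :
    CFC.abs R ^ p = (star R * R) ^ (p / 2) := by
  rw [← CFC.abs_mul_abs, ← pow_two, ← CFC.rpow_natCast _ 2 (CFC.abs_nonneg R),
    CFC.rpow_rpow_of_exponent_nonneg _ _ _ (by norm_num) (by linarith)]
  congr 1
  push_cast; ring

theorem star_mul_mul_le (S T : H →L[ℂ] H) :
    star (S * T) * (S * T) ≤ (‖S‖₊ ^ 2) • (star T * T) := by
  have h2 : star S * S ≤ algebraMap ℝ _ (‖S‖ ^ 2) := by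
    have := IsSelfAdjoint.le_algebraMap_norm_self (IsSelfAdjoint.star_mul_self S)
    rwa [CStarRing.norm_star_mul_self, ← pow_two] at this
  have h3 := star_left_conjugate_le_conjugate h2 T
  have e1 : star (S * T) * (S * T) = star T * (star S * S) * T := by
    rw [star_mul]; simp only [mul_assoc]
  have e2 : (‖S‖₊ ^ 2) • (star T * T) = star T * algebraMap ℝ _ (‖S‖ ^ 2) * T := by
    rw [Algebra.algebraMap_eq_smul_one, mul_smul_comm, mul_one, smul_mul_assoc]
    rfl
  rw [e1, e2]
  exact h3

theorem schattenENorm_mul_le (p : ℝ) (hp : p ∈ Set.Icc (1:ℝ) 2) (S T : H →L[ℂ] H) :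
    schattenENorm p (S * T) ≤ ‖S‖ₑ * schattenENorm p T := by
  have hp0 : 0 < p := by linarith [hp.1]
  have h2 := CFC.rpow_le_rpow (p := p / 2) ⟨by linarith [hp.1], by linarith [hp.2]⟩
    (star_mul_mul_le S T)
  rw [rpow_smul' _ (star_mul_self_nonneg T) _ (by linarith), ← abs_rpow _ hp0,
    ← abs_rpow _ hp0] at h2
  have h4 := trace_mono CFC.rpow_nonneg h2
  rw [trace_smul] at h4
  have h5 : (‖S‖₊ ^ 2) ^ (p / 2) = ‖S‖₊ ^ p := by
    rw [← NNReal.rpow_natCast, ← NNReal.rpow_mul]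
    congr 1
    push_cast; ring
  rw [h5] at h4
  unfold schattenENorm
  calc _ ≤ ((↑(‖S‖₊ ^ p) : ℝ≥0∞) * trace (CFC.abs T ^ p)) ^ (1 / p) := by gcongr
    _ = _ := by
      rw [ENNReal.mul_rpow_of_nonneg _ _ (by positivity), ENNReal.coe_rpow_of_nonneg _ hp0.le,
        ← ENNReal.rpow_mul, mul_one_div_cancel hp0.ne', ENNReal.rpow_one]
      rfl

theorem abs_rpow_half (T : H →L[ℂ] H) {p : ℝ} (hp0 : 0 < p) :
    CFC.abs T ^ p = CFC.abs T ^ (p / 2) * CFC.abs T ^ (p / 2) := by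
  rw [← rpow_add' _ (by linarith) (by linarith) (by linarith)]
  congr 1; ring

theorem enorm_le_schattenENorm (p : ℝ) (hp : p ∈ Set.Icc (1:ℝ) 2) (T : H →L[ℂ] H) :
    ‖T‖ₑ ≤ schattenENorm p T := by
  have hp0 : 0 < p := by linarith [hp.1]
  obtain ⟨w, b, -⟩ := exists_hilbertBasis ℂ H
  set D := CFC.abs T ^ (p / 2) with hD
  have hD0 : 0 ≤ D := CFC.rpow_nonneg
  have h1 : trace (CFC.abs T ^ p) = ∑' i, ‖D (b i)‖ₑ ^ 2 := by
    rw [abs_rpow_half T hp0, trace_mul_self b D hD0]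
  rcases eq_or_ne (trace (CFC.abs T ^ p)) ∞ with h | h
  · rw [schattenENorm, h, ENNReal.top_rpow_of_pos (by positivity)]; exact le_top
  have h2 : ‖D‖ ≤ √ (trace (CFC.abs T ^ p)).toReal := by
    refine ContinuousLinearMap.opNorm_le_bound _ (Real.sqrt_nonneg _) fun x => ?_
    have := hs_bound b D x
    rw [← h1] at this
    have h3 := ENNReal.toReal_mono (by finiteness) this
    simp only [ENNReal.toReal_pow, toReal_enorm, ENNReal.toReal_mul] at h3
    refine le_of_sq_le_sq ?_ (by positivity)
    rwa [mul_pow, Real.sq_sqrt (by positivity)]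
  have h3 : ‖D‖ = ‖T‖ ^ (p / 2) := by
    rw [hD, CFC.norm_rpow _ (by positivity) (CFC.abs_nonneg T), CFC.norm_abs]
  rw [h3] at h2
  have h4 : ‖T‖ ^ p ≤ (trace (CFC.abs T ^ p)).toReal := by
    have := pow_le_pow_left₀ (by positivity) h2 2
    rw [Real.sq_sqrt (by positivity), ← Real.rpow_natCast, ← Real.rpow_mul (norm_nonneg _)] at this
    simpa using this
  have h5 : ‖T‖ₑ ^ p ≤ trace (CFC.abs T ^ p) := by
    rw [← ofReal_norm, ENNReal.ofReal_rpow_of_nonneg (norm_nonneg _) hp0.le]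
    exact (ENNReal.ofReal_le_iff_le_toReal h).mpr h4
  rw [schattenENorm, one_div]
  exact (ENNReal.le_rpow_inv_iff hp0).mpr h5

theorem compact_of_schattenENorm (p : ℝ) (hp : p ∈ Set.Icc (1:ℝ) 2) (T : H →L[ℂ] H)
    (hT : schattenENorm p T ≠ ∞) : IsCompactOperator T := by
  have hp0 : 0 < p := by linarith [hp.1]
  obtain ⟨w, b, -⟩ := exists_hilbertBasis ℂ H
  set D := CFC.abs T ^ (p / 2) with hD
  have hD0 : 0 ≤ D := CFC.rpow_nonneg
  have h1 : trace (CFC.abs T ^ p) = ∑' i, ‖D (b i)‖ₑ ^ 2 := by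
    rw [abs_rpow_half T hp0, trace_mul_self b D hD0]
  have h2 : trace (CFC.abs T ^ p) ≠ ∞ := by
    intro h
    rw [schattenENorm, h, ENNReal.top_rpow_of_pos (by positivity)] at hT
    exact hT rfl
  have h3 : CFC.abs T = CFC.abs T ^ (1 - p / 2) * D := by
    rw [hD, ← rpow_add' _ (by linarith [hp.2]) (by linarith) (by norm_num),
      sub_add_cancel, CFC.rpow_one _ (CFC.abs_nonneg T)]
  have h4 : ∀ x, ‖T x‖ = ‖CFC.abs T x‖ := by
    intro x
    have h5 : ∀ R : H →L[ℂ] H, ‖R x‖ ^ 2 = RCLike.re (inner ℂ ((star R * R) x) x) := by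
      intro R
      rw [mul_apply_eq_comp, ContinuousLinearMap.star_eq_adjoint,
        ContinuousLinearMap.adjoint_inner_left, inner_self_eq_norm_sq]
    have h6 : star (CFC.abs T) * CFC.abs T = star T * T := by
      rw [(IsSelfAdjoint.of_nonneg (CFC.abs_nonneg T)).star_eq, CFC.abs_mul_abs]
    have h7 : ‖T x‖ ^ 2 = ‖CFC.abs T x‖ ^ 2 := by rw [h5, h5, h6]
    exact (sq_eq_sq₀ (norm_nonneg _) (norm_nonneg _)).mp h7
  refine hs_compact b T ?_
  refine ne_top_of_le_ne_top (b := ‖CFC.abs T ^ (1 - p / 2)‖ₑ ^ 2 * trace (CFC.abs T ^ p))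
    (by finiteness) ?_
  rw [h1, ← ENNReal.tsum_mul_left]
  refine ENNReal.tsum_le_tsum fun i => ?_
  rw [← mul_pow]
  gcongr
  rw [← ofReal_norm, h4, ofReal_norm]
  nth_rw 1 [h3]
  rw [mul_apply_eq_comp]
  exact ContinuousLinearMap.le_opENorm _ _

/-- Singular value decomposition of a compact operator. -/
theorem svd (T : H →L[ℂ] H) (hT : IsCompactOperator T) :
    ∃ (ι : Type u) (b : HilbertBasis ι ℂ H) (μ : ι → NNReal) (h : ι → H),
      (∀ i, T (b i) = ((μ i : ℝ) : ℂ) • h i) ∧ (∀ i, inner ℂ (h i) (T (b i)) = ((μ i : ℝ) : ℂ)) ∧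
      (∀ i, ‖h i‖ₑ ≤ 1) ∧ (∀ x, ∑' i, ‖inner ℂ (h i) x‖ₑ ^ 2 ≤ ‖x‖ₑ ^ 2) ∧
      ∀ p : ℝ, 0 < p → trace (CFC.abs T ^ p) = ∑' i, (μ i : ℝ≥0∞) ^ p := by
  classical
  have hc : IsCompactOperator (star T * T : H →L[ℂ] H) := hT.clm_comp (star T)
  obtain ⟨ι, b, l, hl⟩ := eigenbasis (star T * T) hc (star_mul_self_nonneg T)
  have hin : ∀ i j, inner ℂ (T (b i)) (T (b j)) = if i = j then ((l j : ℝ) : ℂ) else 0 := by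
    intro i j
    rw [← ContinuousLinearMap.adjoint_inner_right]
    have : T.adjoint (T (b j)) = ((l j : ℝ) : ℂ) • b j := hl j
    rw [this, inner_smul_right, orthonormal_iff_ite.mp b.orthonormal]
    simp
  let μ : ι → NNReal := fun i => NNReal.sqrt (l i)
  have hμ : ∀ i, ((μ i : ℝ) : ℂ) * ((μ i : ℝ) : ℂ) = ((l i : ℝ) : ℂ) := by
    intro i
    have : μ i * μ i = l i := NNReal.mul_self_sqrt (l i)
    exact_mod_cast this
  let h : ι → H := fun i => ((μ i : ℝ) : ℂ)⁻¹ • T (b i)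
  have hT0 : ∀ i, μ i = 0 → T (b i) = 0 := by
    intro i hi
    have h1 := hin i i
    rw [if_pos rfl, ← hμ, hi] at h1
    refine inner_self_eq_zero (𝕜 := ℂ) |>.mp ?_
    rw [h1]; simp
  have horth : ∀ i j, μ j ≠ 0 → inner ℂ (h i) (h j) = if i = j then (1 : ℂ) else 0 := by
    intro i j hj
    have hj' : ((μ j : ℝ) : ℂ) ≠ 0 := by exact_mod_cast hj
    simp only [h, inner_smul_left, inner_smul_right, hin]
    split_ifs with hij
    · subst hij
      rw [← hμ]
      simp [Complex.conj_ofReal]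
      field_simp
    · simp
  have hz : ∀ i, μ i = 0 → h i = 0 := by
    intro i hi
    simp [h, hT0 i hi]
  refine ⟨ι, b, μ, h, ?_, ?_, ?_, ?_, ?_⟩
  · intro i
    rcases eq_or_ne (μ i) 0 with hi | hi
    · rw [hT0 i hi, hi]; simp
    · have hi' : ((μ i : ℝ) : ℂ) ≠ 0 := by exact_mod_cast hi
      simp only [h, smul_smul]
      rw [mul_inv_cancel₀ hi', one_smul]
  · intro i
    simp only [h, inner_smul_left, hin, if_pos]
    rw [← hμ, map_inv₀, Complex.conj_ofReal]
    rcases eq_or_ne (μ i) 0 with hi | hi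
    · simp [hi]
    · have hi' : ((μ i : ℝ) : ℂ) ≠ 0 := by exact_mod_cast hi
      field_simp
  · intro i
    rcases eq_or_ne (μ i) 0 with hi | hi
    · simp [hz i hi]
    · have h1 := horth i i hi
      rw [if_pos rfl, inner_self_eq_norm_sq_to_K] at h1
      have h2 : ‖h i‖ ^ 2 = 1 := by
        have := congrArg Complex.re h1
        norm_cast at this
      have h3 : ‖h i‖ = 1 := by nlinarith [norm_nonneg (h i)]
      rw [← ofReal_norm, h3]; simp
  · intro x
    have ho : Orthonormal ℂ (fun i : {i // μ i ≠ 0} => h i) := by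
      rw [orthonormal_iff_ite]
      intro i j
      rw [horth _ _ j.2]
      simp [Subtype.ext_iff]
    have h1 : ∑' i, ‖inner ℂ (h i) x‖ₑ ^ 2 = ∑' i : {i // μ i ≠ 0}, ‖inner ℂ (h i) x‖ₑ ^ 2 := by
      rw [← tsum_subtype_eq_of_support_subset (s := {i | μ i ≠ 0})]
      · rfl
      · intro i hi hi0
        simp [hz i hi0] at hi
    rw [h1]
    have h2 := ho.tsum_inner_products_le (x := x)
    have h3 := ENNReal.ofReal_tsum_of_nonneg
      (f := fun i : {i // μ i ≠ 0} => ‖inner ℂ (h i) x‖ ^ 2) (fun i => by positivity)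
      (ho.inner_products_summable (x := x))
    have h4 := ENNReal.ofReal_le_ofReal h2
    rw [h3] at h4
    simpa [ENNReal.ofReal_pow] using h4
  · intro p hp
    rw [abs_rpow T hp, trace_eq b _ CFC.rpow_nonneg]
    refine tsum_congr fun i => ?_
    have h1 : ((star T * T) ^ (p / 2)) (b i) = (((l i : ℝ) ^ (p / 2) : ℝ) : ℂ) • b i := by
      rw [CFC.rpow_eq_cfc_real (star_mul_self_nonneg T)]
      have hc : Continuous (fun x : ℝ => x ^ (p / 2)) :=
        Real.continuous_rpow_const (by positivity)
      exact cfc_eigen _ (IsSelfAdjoint.star_mul_self T) _ hc.continuousOn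
        _ _ (b.orthonormal.ne_zero i) (hl i)
    rw [h1, inner_smul_left, orthonormal_iff_ite.mp b.orthonormal, if_pos rfl, Complex.conj_ofReal,
      mul_one]
    have h2 : (l i : ℝ) = (μ i : ℝ) ^ (2 : ℝ) := by
      have : l i = μ i ^ 2 := (NNReal.sq_sqrt (l i)).symm
      rw [this]; norm_cast
    rw [h2, ← Real.rpow_mul (by positivity)]
    have h3 : (2 : ℝ) * (p / 2) = p := by ring
    rw [h3]
    change ENNReal.ofReal ((μ i : ℝ) ^ p) = _
    rw [← ENNReal.ofReal_rpow_of_nonneg (by positivity) hp.le, ENNReal.ofReal_coe_nnreal]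

theorem jensen {κ : Type*} (w f : κ → ℝ≥0∞) (hw : ∑' k, w k ≤ 1) {p : ℝ} (hp : 1 ≤ p) :
    (∑' k, w k * f k) ^ p ≤ ∑' k, w k * f k ^ p := by
  have hp0 : 0 < p := by linarith
  rw [← ENNReal.le_rpow_inv_iff hp0, ENNReal.tsum_eq_iSup_sum]
  refine iSup_le fun s => ?_
  refine (ENNReal.inner_le_weight_mul_Lp_of_nonneg s hp w f).trans ?_
  have h1 : (∑ i ∈ s, w i) ^ (1 - p⁻¹) ≤ 1 := by
    refine ENNReal.rpow_le_one ((ENNReal.sum_le_tsum s).trans hw) ?_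
    have := inv_le_one_of_one_le₀ hp
    linarith
  calc _ ≤ 1 * (∑' k, w k * f k ^ p) ^ p⁻¹ := by
        gcongr
        exact ENNReal.sum_le_tsum s
    _ = _ := one_mul _

theorem minkowski {κ : Type*} (f g : κ → ℝ≥0∞) {p : ℝ} (hp : 1 ≤ p) :
    (∑' k, (f k + g k) ^ p) ^ (1 / p) ≤ (∑' k, f k ^ p) ^ (1 / p) + (∑' k, g k ^ p) ^ (1 / p) := by
  have hp0 : 0 < p := by linarith
  rw [one_div, ENNReal.rpow_inv_le_iff hp0, ENNReal.tsum_eq_iSup_sum]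
  refine iSup_le fun s => ?_
  rw [← ENNReal.rpow_inv_le_iff hp0, ← one_div]
  refine (ENNReal.Lp_add_le s f g hp).trans ?_
  gcongr <;> exact ENNReal.sum_le_tsum s

theorem tsum_mul_le_one {κ : Type*} (f g : κ → ℝ≥0∞) (hf : ∑' k, f k ^ 2 ≤ 1)
    (hg : ∑' k, g k ^ 2 ≤ 1) : ∑' k, f k * g k ≤ 1 := by
  rw [ENNReal.tsum_eq_iSup_sum]
  refine iSup_le fun s => ?_
  have h := ENNReal.inner_le_Lp_mul_Lq s f g (p := 2) (q := 2) (by constructor <;> norm_num)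
  refine h.trans ?_
  refine mul_le_one₀ ?_ ?_ ?_
  · refine ENNReal.rpow_le_one ?_ (by norm_num)
    refine le_trans ?_ ((ENNReal.sum_le_tsum s).trans hf)
    norm_cast
  · exact zero_le
  · refine ENNReal.rpow_le_one ?_ (by norm_num)
    refine le_trans ?_ ((ENNReal.sum_le_tsum s).trans hg)
    norm_cast

theorem tsum_inner_le (S : H →L[ℂ] H) (hS : IsCompactOperator S) {p : ℝ} (hp : 1 ≤ p)
    {ι : Type*} (e f : ι → H) (he1 : ∀ i, ‖e i‖ₑ ≤ 1) (hf1 : ∀ i, ‖f i‖ₑ ≤ 1)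
    (he : ∀ x, ∑' i, ‖inner ℂ (e i) x‖ₑ ^ 2 ≤ ‖x‖ₑ ^ 2)
    (hf : ∀ x, ∑' i, ‖inner ℂ (f i) x‖ₑ ^ 2 ≤ ‖x‖ₑ ^ 2) :
    ∑' i, ‖inner ℂ (f i) (S (e i))‖ₑ ^ p ≤ trace (CFC.abs S ^ p) := by
  have hp0 : 0 < p := by linarith
  obtain ⟨κ, b, μ, h, h1, h2, h3, h4, h5⟩ := svd S hS
  rw [h5 p hp0]
  let a : ι → κ → ℝ≥0∞ := fun i k => ‖inner ℂ (b k) (e i)‖ₑ * ‖inner ℂ (f i) (h k)‖ₑ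
  have hsymm : ∀ x y : H, ‖inner ℂ x y‖ₑ = ‖inner ℂ y x‖ₑ := by
    intro x y
    rw [← ofReal_norm, ← ofReal_norm, norm_inner_symm]
  have hle1 : ∀ x : ℝ≥0∞, x ≤ 1 → x ^ 2 ≤ 1 := fun x hx => pow_le_one₀ zero_le hx
  have hak : ∀ i, ∑' k, a i k ≤ 1 := by
    intro i
    refine tsum_mul_le_one _ _ ?_ ?_
    · rw [parseval]; exact hle1 _ (he1 i)
    · simp_rw [hsymm (f i)]
      exact (h4 (f i)).trans (hle1 _ (hf1 i))
  have hai : ∀ k, ∑' i, a i k ≤ 1 := by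
    intro k
    refine tsum_mul_le_one _ _ ?_ ?_
    · simp_rw [hsymm (b k)]
      refine (he (b k)).trans (hle1 _ ?_)
      rw [← ofReal_norm, b.orthonormal.1 k]; simp
    · exact (hf (h k)).trans (hle1 _ (h3 k))
  have hmain : ∀ i, ‖inner ℂ (f i) (S (e i))‖ₑ ≤ ∑' k, a i k * (μ k : ℝ≥0∞) := by
    intro i
    have hs := ((b.hasSum_repr (e i)).mapL S).mapL (innerSL ℂ (f i))
    have hs2 := hs.tsum_eq
    simp only [innerSL_apply_apply] at hs2
    rw [← hs2]
    refine enorm_tsum_le_tsum_enorm.trans ?_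
    refine ENNReal.tsum_le_tsum fun k => ?_
    rw [map_smul, h1, inner_smul_right, inner_smul_right, b.repr_apply_apply, enorm_mul, enorm_mul]
    have : ‖((μ k : ℝ) : ℂ)‖ₑ = μ k := by
      rw [← ofReal_norm]; simp
    rw [this]
    simp only [a]
    rw [mul_comm (μ k : ℝ≥0∞), mul_assoc]
  calc ∑' i, ‖inner ℂ (f i) (S (e i))‖ₑ ^ p ≤ ∑' i, ∑' k, a i k * (μ k : ℝ≥0∞) ^ p := by
        refine ENNReal.tsum_le_tsum fun i => ?_
        exact (ENNReal.rpow_le_rpow (hmain i) hp0.le).trans (jensen _ _ (hak i) hp)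
    _ = ∑' k, (∑' i, a i k) * (μ k : ℝ≥0∞) ^ p := by
        rw [ENNReal.tsum_comm]
        simp_rw [ENNReal.tsum_mul_right]
    _ ≤ ∑' k, 1 * (μ k : ℝ≥0∞) ^ p := by
        refine ENNReal.tsum_le_tsum fun k => ?_
        gcongr
        exact hai k
    _ = _ := by simp

theorem schattenENorm_add_le (p : ℝ) (hp : p ∈ Set.Icc (1:ℝ) 2) (S T : H →L[ℂ] H) :
    schattenENorm p (S + T) ≤ schattenENorm p S + schattenENorm p T := by
  rcases eq_or_ne (schattenENorm p S) ∞ with hS | hS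
  · simp [hS]
  rcases eq_or_ne (schattenENorm p T) ∞ with hT | hT
  · simp [hT]
  have cS := compact_of_schattenENorm p hp S hS
  have cT := compact_of_schattenENorm p hp T hT
  obtain ⟨ι, b, μ, h, h1, h2, h3, h4, h5⟩ := svd (S + T) (cS.add cT)
  have hp0 : 0 < p := by linarith [hp.1]
  have hb1 : ∀ i, ‖b i‖ₑ ≤ 1 := fun i => by
    rw [← ofReal_norm, b.orthonormal.1 i]; simp
  unfold schattenENorm
  rw [h5 p hp0]
  have hle : ∀ i, (μ i : ℝ≥0∞) ≤ ‖inner ℂ (h i) (S (b i))‖ₑ + ‖inner ℂ (h i) (T (b i))‖ₑ := by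
    intro i
    have e1 : ‖((μ i : ℝ) : ℂ)‖ₑ = μ i := by
      rw [← ofReal_norm]; simp
    rw [← e1, ← h2 i, add_apply, inner_add_right]
    exact enorm_add_le _ _
  calc _ ≤ (∑' i, (‖inner ℂ (h i) (S (b i))‖ₑ + ‖inner ℂ (h i) (T (b i))‖ₑ) ^ p) ^ (1 / p) := by
        gcongr with i
        exact hle i
    _ ≤ _ := minkowski _ _ hp.1
    _ ≤ _ := by
        gcongr
        · exact tsum_inner_le S cS hp.1 _ _ hb1 h3 (fun x => (parseval b x).le) h4
        · exact tsum_inner_le T cT hp.1 _ _ hb1 h3 (fun x => (parseval b x).le) h4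

theorem schattenENorm_zero {p : ℝ} (hp : 0 < p) : schattenENorm p (0 : H →L[ℂ] H) = 0 := by
  have : (0 : H →L[ℂ] H) ^ p = 0 := CFC.zero_rpow hp.ne'
  simp [schattenENorm, CFC.abs_zero, this, trace, hp]

theorem schattenENorm_smul_le (p : ℝ) (hp : p ∈ Set.Icc (1:ℝ) 2) (c : ℂ) (T : H →L[ℂ] H) :
    schattenENorm p (c • T) ≤ ‖c‖ₑ * schattenENorm p T := by
  have h1 : c • T = (c • (1 : H →L[ℂ] H)) * T := by simp
  have h2 : ‖c • (1 : H →L[ℂ] H)‖ₑ ≤ ‖c‖ₑ := by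
    rw [← ofReal_norm, ← ofReal_norm]
    refine ENNReal.ofReal_le_ofReal ?_
    refine ContinuousLinearMap.opNorm_le_bound _ (norm_nonneg _) fun x => ?_
    simp [norm_smul]
  rw [h1]
  exact (schattenENorm_mul_le p hp _ T).trans (by gcongr)

/-- The ideal of Schatten `p`-class operators `{T ∈ B(H) : ‖T‖_p < ∞}`, as a subalgebra of
`B(H)`. -/
def schattenIdeal (p : ℝ) [hp : Fact (p ∈ Set.Icc (1 : ℝ) 2)] (H : Type u) [NormedAddCommGroup H]
    [InnerProductSpace ℂ H] [CompleteSpace H] : NonUnitalSubalgebra ℂ (H →L[ℂ] H) where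
  carrier := {T | schattenENorm p T < ∞}
  zero_mem' := by
    have := schattenENorm_zero (H := H) (p := p) (by linarith [hp.out.1])
    simp [this]
  add_mem' {S T} hS hT :=
    (schattenENorm_add_le p hp.out S T).trans_lt (ENNReal.add_lt_top.mpr ⟨hS, hT⟩)
  mul_mem' {S T} _ hT :=
    (schattenENorm_mul_le p hp.out S T).trans_lt (ENNReal.mul_lt_top enorm_lt_top hT)
  smul_mem' c T hT :=
    (schattenENorm_smul_le p hp.out c T).trans_lt (ENNReal.mul_lt_top enorm_lt_top hT)

/-- The normed algebra `S_p(H)` of Schatten `p`-class operators, `1 ≤ p ≤ 2`, with composition as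
product and the norm `‖·‖_p`. -/
def SchattenClass (p : ℝ) [Fact (p ∈ Set.Icc (1 : ℝ) 2)] (H : Type u) [NormedAddCommGroup H]
    [InnerProductSpace ℂ H] [CompleteSpace H] : Type u :=
  ↥(schattenIdeal p H)

namespace SchattenClass

variable {p : ℝ} [hp : Fact (p ∈ Set.Icc (1 : ℝ) 2)]

/-- The inclusion `S_p(H) ⊆ B(H)`. -/
def toCLM (T : SchattenClass p H) : H →L[ℂ] H := Subtype.val T

noncomputable instance : NonUnitalRing (SchattenClass p H) :=
  inferInstanceAs (NonUnitalRing ↥(schattenIdeal p H))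

noncomputable instance : Module ℂ (SchattenClass p H) :=
  inferInstanceAs (Module ℂ ↥(schattenIdeal p H))

instance : IsScalarTower ℂ (SchattenClass p H) (SchattenClass p H) :=
  inferInstanceAs (IsScalarTower ℂ ↥(schattenIdeal p H) ↥(schattenIdeal p H))

instance : SMulCommClass ℂ (SchattenClass p H) (SchattenClass p H) :=
  inferInstanceAs (SMulCommClass ℂ ↥(schattenIdeal p H) ↥(schattenIdeal p H))

noncomputable instance : Norm (SchattenClass p H) :=
  ⟨fun T => (schattenENorm p T.toCLM).toReal⟩

theorem norm_def (T : SchattenClass p H) : ‖T‖ = (schattenENorm p T.toCLM).toReal := rfl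

theorem schattenENorm_ne_top (T : SchattenClass p H) : schattenENorm p T.toCLM ≠ ∞ := T.2.ne

theorem norm_smul_le' (c : ℂ) (T : SchattenClass p H) : ‖c • T‖ ≤ ‖c‖ * ‖T‖ := by
  have h := schattenENorm_smul_le p hp.out c T.toCLM
  have := ENNReal.toReal_mono (ENNReal.mul_ne_top enorm_ne_top T.schattenENorm_ne_top) h
  rwa [ENNReal.toReal_mul, toReal_enorm] at this

theorem opNorm_le (T : SchattenClass p H) : ‖T.toCLM‖ ≤ ‖T‖ := by
  have := ENNReal.toReal_mono T.schattenENorm_ne_top (enorm_le_schattenENorm p hp.out T.toCLM)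
  rwa [toReal_enorm] at this

noncomputable instance : NormedAddCommGroup (SchattenClass p H) :=
  AddGroupNorm.toNormedAddCommGroup
    { toFun := fun T => ‖T‖
      map_zero' := by
        rw [norm_def]
        change (schattenENorm p (0 : H →L[ℂ] H)).toReal = 0
        rw [schattenENorm_zero (by linarith [hp.out.1])]
        rfl
      add_le' := fun S T => by
        have h := schattenENorm_add_le p hp.out S.toCLM T.toCLM
        have h2 := ENNReal.toReal_mono
          (ENNReal.add_ne_top.mpr ⟨S.schattenENorm_ne_top, T.schattenENorm_ne_top⟩) h
        rwa [ENNReal.toReal_add S.schattenENorm_ne_top T.schattenENorm_ne_top] at h2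
      neg' := fun T => by
        have h : ∀ T : SchattenClass p H, ‖-T‖ ≤ ‖T‖ := fun T => by
          have := norm_smul_le' (-1 : ℂ) T
          simpa using this
        exact le_antisymm (h T) (by simpa using h (-T))
      eq_zero_of_map_eq_zero' := fun T hT => by
        have h := opNorm_le T
        rw [hT] at h
        exact Subtype.ext (norm_le_zero_iff.mp h) }

noncomputable instance : NonUnitalNormedRing (SchattenClass p H) where
  __ := (inferInstance : NormedAddCommGroup (SchattenClass p H))
  __ := (inferInstance : NonUnitalRing (SchattenClass p H))
  norm_mul_le S T := by
    have h := schattenENorm_mul_le p hp.out S.toCLM T.toCLM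
    have h2 := ENNReal.toReal_mono (ENNReal.mul_ne_top enorm_ne_top T.schattenENorm_ne_top) h
    rw [ENNReal.toReal_mul, toReal_enorm] at h2
    exact h2.trans (mul_le_mul_of_nonneg_right (opNorm_le S) (norm_nonneg T))

noncomputable instance : NormedSpace ℂ (SchattenClass p H) where
  norm_smul_le := norm_smul_le'

end SchattenClass

open scoped TensorProduct

universe v w

section Completion

universe w'

variable (R : Type w') [NonUnitalSeminormedRing R] [NormedSpace ℂ R]

/-- The completion of a (not necessarily unital) seminormed algebra, with the product extended by
continuity. -/
def NormedRingCompletion : Type w' := UniformSpace.Completion R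

namespace NormedRingCompletion

open UniformSpace UniformSpace.Completion

noncomputable instance : NormedAddCommGroup (NormedRingCompletion R) :=
  inferInstanceAs (NormedAddCommGroup (Completion R))

noncomputable instance : NormedSpace ℂ (NormedRingCompletion R) :=
  inferInstanceAs (NormedSpace ℂ (Completion R))

instance : CompleteSpace (NormedRingCompletion R) :=
  inferInstanceAs (CompleteSpace (Completion R))

variable {R}

/-- The canonical map `R → NormedRingCompletion R`. -/
noncomputable def of : R →L[ℂ] NormedRingCompletion R :=
  (toComplL : R →L[ℂ] Completion R)

theorem isDenseInducing_of : IsDenseInducing (of : R → NormedRingCompletion R) :=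
  isDenseInducing_coe

theorem norm_of (u : R) : ‖of u‖ = ‖u‖ := Completion.norm_coe u

/-- The product of the completion: the continuous extension of the product of `R`. -/
@[irreducible] noncomputable def mul (x y : NormedRingCompletion R) : NormedRingCompletion R :=
  (isDenseInducing_of.prodMap isDenseInducing_of).extend (fun z : R × R => of (z.1 * z.2)) (x, y)

noncomputable instance : Mul (NormedRingCompletion R) := ⟨mul⟩

theorem of_mul (u v : R) : of (u * v) = of u * of v := by
  change of (u * v) = mul (of u) (of v)
  unfold mul
  exact ((isDenseInducing_of.prodMap isDenseInducing_of).extend_eq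
    (f := fun z : R × R => of (z.1 * z.2)) (by fun_prop) (u, v)).symm

theorem continuous_mul' : Continuous fun z : NormedRingCompletion R × NormedRingCompletion R =>
    z.1 * z.2 := by
  let m := (AddMonoidHom.mul : R →+ _ →+ R).compr₂
    (of : R →L[ℂ] NormedRingCompletion R).toLinearMap.toAddMonoidHom
  have hm : Continuous fun z : R × R => m z.1 z.2 := by
    change Continuous fun z : R × R => of (z.1 * z.2)
    fun_prop
  let i : R →+ NormedRingCompletion R :=
    (of : R →L[ℂ] NormedRingCompletion R).toLinearMap.toAddMonoidHom
  have di : IsDenseInducing i := isDenseInducing_of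
  have h := di.extend_Z_bilin di hm
  change Continuous fun z : NormedRingCompletion R × NormedRingCompletion R => mul z.1 z.2
  unfold mul
  exact h

instance : ContinuousMul (NormedRingCompletion R) := ⟨continuous_mul'⟩

theorem induction_of {P : NormedRingCompletion R → Prop} (x : NormedRingCompletion R)
    (hP : IsClosed {x | P x}) (h : ∀ u, P (of u)) : P x :=
  isDenseInducing_of.dense.induction (by rintro _ ⟨u, rfl⟩; exact h u) hP x

theorem isClosed_eq_of {f g : NormedRingCompletion R → NormedRingCompletion R} (hf : Continuous f)
    (hg : Continuous g) (h : ∀ u : R, f (of u) = g (of u))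
    (x : NormedRingCompletion R) : f x = g x :=
  induction_of (P := fun x => f x = g x) x (isClosed_eq hf hg) h

theorem of_add (u v : R) : of (u + v) = of u + of v := map_add _ _ _

theorem of_zero : of (0 : R) = 0 := map_zero _

theorem of_smul (c : ℂ) (u : R) : of (c • u) = c • of u := map_smul _ _ _

theorem mul_add' (x y z : NormedRingCompletion R) : x * (y + z) = x * y + x * z := by
  revert x
  refine isClosed_eq_of (by fun_prop) (by fun_prop) fun u => ?_
  revert y
  refine isClosed_eq_of (by fun_prop) (by fun_prop) fun v => ?_
  revert z
  refine isClosed_eq_of (by fun_prop) (by fun_prop) fun w => ?_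
  rw [← of_add, ← of_mul, ← of_mul, ← of_mul, mul_add, of_add]

theorem add_mul' (x y z : NormedRingCompletion R) : (x + y) * z = x * z + y * z := by
  revert x
  refine isClosed_eq_of (by fun_prop) (by fun_prop) fun u => ?_
  revert y
  refine isClosed_eq_of (by fun_prop) (by fun_prop) fun v => ?_
  revert z
  refine isClosed_eq_of (by fun_prop) (by fun_prop) fun w => ?_
  rw [← of_add, ← of_mul, ← of_mul, ← of_mul, add_mul, of_add]

theorem mul_assoc' (x y z : NormedRingCompletion R) : x * y * z = x * (y * z) := by
  revert x
  refine isClosed_eq_of (by fun_prop) (by fun_prop) fun u => ?_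
  revert y
  refine isClosed_eq_of (by fun_prop) (by fun_prop) fun v => ?_
  revert z
  refine isClosed_eq_of (by fun_prop) (by fun_prop) fun w => ?_
  rw [← of_mul, ← of_mul, ← of_mul, ← of_mul, mul_assoc]

theorem zero_mul' : ∀ x : NormedRingCompletion R, 0 * x = 0 := by
  refine isClosed_eq_of (by fun_prop) (by fun_prop) fun u => ?_
  rw [← of_zero, ← of_mul, zero_mul]

theorem mul_zero' : ∀ x : NormedRingCompletion R, x * 0 = 0 := by
  refine isClosed_eq_of (by fun_prop) (by fun_prop) fun u => ?_
  rw [← of_zero, ← of_mul, mul_zero]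

theorem norm_mul_le' (x y : NormedRingCompletion R) : ‖x * y‖ ≤ ‖x‖ * ‖y‖ := by
  refine induction_of (P := fun x => ‖x * y‖ ≤ ‖x‖ * ‖y‖) x
    (isClosed_le (by fun_prop) (by fun_prop)) fun u => ?_
  refine induction_of (P := fun y => ‖of u * y‖ ≤ ‖of u‖ * ‖y‖) y
    (isClosed_le (by fun_prop) (by fun_prop)) fun v => ?_
  rw [← of_mul, norm_of, norm_of, norm_of]
  exact norm_mul_le u v

noncomputable instance : NonUnitalNormedRing (NormedRingCompletion R) where
  __ := (inferInstance : NormedAddCommGroup (NormedRingCompletion R))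
  __ := (inferInstance : Mul (NormedRingCompletion R))
  left_distrib := mul_add'
  right_distrib := add_mul'
  zero_mul := zero_mul'
  mul_zero := mul_zero'
  mul_assoc := mul_assoc'
  norm_mul_le := norm_mul_le'

theorem continuous_smul' (c : ℂ) : Continuous fun x : NormedRingCompletion R => c • x :=
  (c • ContinuousLinearMap.id ℂ (NormedRingCompletion R)).continuous

instance [IsScalarTower ℂ R R] :
    IsScalarTower ℂ (NormedRingCompletion R) (NormedRingCompletion R) where
  smul_assoc c x y := by
    change c • x * y = c • (x * y)
    revert x
    refine isClosed_eq_of ((continuous_smul' c).mul continuous_const)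
      ((continuous_smul' c).comp (continuous_id.mul continuous_const)) fun u => ?_
    revert y
    refine isClosed_eq_of (continuous_const.mul continuous_id)
      ((continuous_smul' c).comp (continuous_const.mul continuous_id)) fun v => ?_
    rw [← of_smul, ← of_mul, ← of_mul, ← of_smul, smul_mul_assoc]

instance [SMulCommClass ℂ R R] :
    SMulCommClass ℂ (NormedRingCompletion R) (NormedRingCompletion R) where
  smul_comm c x y := by
    change c • (x * y) = x * c • y
    revert x
    refine isClosed_eq_of ((continuous_smul' c).comp (continuous_id.mul continuous_const))
      (continuous_id.mul continuous_const) fun u => ?_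
    revert y
    refine isClosed_eq_of ((continuous_smul' c).comp (continuous_const.mul continuous_id))
      (continuous_const.mul (continuous_smul' c)) fun v => ?_
    rw [← of_smul, ← of_mul, ← of_mul, ← of_smul, mul_smul_comm]

end NormedRingCompletion

end Completion

section AlgProjectiveTensor

variable (A : Type v) (B : Type w) [NonUnitalNormedRing A] [NormedSpace ℂ A]
  [IsScalarTower ℂ A A] [SMulCommClass ℂ A A] [NonUnitalNormedRing B] [NormedSpace ℂ B]
  [IsScalarTower ℂ B B] [SMulCommClass ℂ B B]

/-- The algebraic tensor product `A ⊗ B`, to be equipped with the projective norm and with the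
product `(a ⊗ b) (a' ⊗ b') = a a' ⊗ b b'`. -/
def AlgProjectiveTensor : Type max v w := A ⊗[ℂ] B

namespace AlgProjectiveTensor

noncomputable instance : NonUnitalRing (AlgProjectiveTensor A B) :=
  inferInstanceAs (NonUnitalRing (A ⊗[ℂ] B))

noncomputable instance : Module ℂ (AlgProjectiveTensor A B) :=
  inferInstanceAs (Module ℂ (A ⊗[ℂ] B))

instance : IsScalarTower ℂ (AlgProjectiveTensor A B) (AlgProjectiveTensor A B) :=
  inferInstanceAs (IsScalarTower ℂ (A ⊗[ℂ] B) (A ⊗[ℂ] B))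

instance : SMulCommClass ℂ (AlgProjectiveTensor A B) (AlgProjectiveTensor A B) :=
  inferInstanceAs (SMulCommClass ℂ (A ⊗[ℂ] B) (A ⊗[ℂ] B))

variable {A B}

/-- The elementary tensor `a ⊗ b`. -/
noncomputable def tmul (a : A) (b : B) : AlgProjectiveTensor A B := a ⊗ₜ[ℂ] b

theorem tmul_mul_tmul (a a' : A) (b b' : B) :
    tmul a b * tmul a' b' = tmul (a * a') (b * b') :=
  Algebra.TensorProduct.tmul_mul_tmul a a' b b'

/-- The tensor `∑ xᵢ ⊗ yᵢ` given by a finite list of pairs. -/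
noncomputable def ofList (l : List (A × B)) : AlgProjectiveTensor A B := (l.map fun x => tmul x.1 x.2).sum

/-- The cost `∑ ‖xᵢ‖ ‖yᵢ‖` of a finite list of pairs. -/
def cost (l : List (A × B)) : ℝ := (l.map fun x => ‖x.1‖ * ‖x.2‖).sum

/-- The projective norm: the infimum of `∑ ‖xᵢ‖ ‖yᵢ‖` over all representations
`u = ∑ xᵢ ⊗ yᵢ`. -/
noncomputable instance : Norm (AlgProjectiveTensor A B) :=
  ⟨fun u => sInf {r : ℝ | ∃ l : List (A × B), ofList l = u ∧ cost l = r}⟩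

theorem norm_def (u : AlgProjectiveTensor A B) :
    ‖u‖ = sInf {r : ℝ | ∃ l : List (A × B), ofList l = u ∧ cost l = r} := rfl

theorem cost_nonneg (l : List (A × B)) : 0 ≤ cost l := by
  refine List.sum_nonneg ?_
  simp only [List.mem_map]
  rintro _ ⟨x, -, rfl⟩
  positivity

theorem exists_ofList (u : AlgProjectiveTensor A B) : ∃ l : List (A × B), ofList l = u := by
  refine TensorProduct.induction_on (motive := fun u => ∃ l : List (A × B), ofList l = u) u
    ⟨[], rfl⟩ (fun a b => ⟨[(a, b)], by simp [ofList]; rfl⟩) ?_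
  rintro x y ⟨l, rfl⟩ ⟨m, rfl⟩
  exact ⟨l ++ m, by simp [ofList]; rfl⟩

theorem norm_le_cost (l : List (A × B)) : ‖ofList l‖ ≤ cost l :=
  csInf_le ⟨0, by rintro _ ⟨m, -, rfl⟩; exact cost_nonneg m⟩ ⟨l, rfl, rfl⟩

theorem exists_cost_lt (u : AlgProjectiveTensor A B) {ε : ℝ} (hε : 0 < ε) :
    ∃ l : List (A × B), ofList l = u ∧ cost l < ‖u‖ + ε := by
  obtain ⟨l₀, h₀⟩ := exists_ofList u
  obtain ⟨_, ⟨l, hl, rfl⟩, h⟩ :=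
    Real.lt_sInf_add_pos (s := {r : ℝ | ∃ l : List (A × B), ofList l = u ∧ cost l = r})
      ⟨_, l₀, h₀, rfl⟩ hε
  exact ⟨l, hl, h⟩

theorem norm_nonneg' (u : AlgProjectiveTensor A B) : 0 ≤ ‖u‖ :=
  Real.sInf_nonneg (by rintro _ ⟨m, -, rfl⟩; exact cost_nonneg m)

theorem norm_add_le' (u v : AlgProjectiveTensor A B) : ‖u + v‖ ≤ ‖u‖ + ‖v‖ := by
  refine le_of_forall_pos_le_add fun ε hε => ?_
  obtain ⟨l, rfl, hl⟩ := exists_cost_lt u (half_pos hε)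
  obtain ⟨m, rfl, hm⟩ := exists_cost_lt v (half_pos hε)
  have h1 : ofList l + ofList m = ofList (l ++ m) := by simp [ofList]
  have h2 : cost (l ++ m) = cost l + cost m := by simp [cost]
  have := norm_le_cost (l ++ m)
  rw [h1]
  linarith

theorem norm_smul_le' (c : ℂ) (u : AlgProjectiveTensor A B) : ‖c • u‖ ≤ ‖c‖ * ‖u‖ := by
  have key : ∀ l : List (A × B), ‖c • ofList l‖ ≤ ‖c‖ * cost l := by
    intro l
    have h1 : c • ofList l = ofList (l.map fun x => (c • x.1, x.2)) := by
      simp only [ofList, List.smul_sum, List.map_map]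
      rfl
    have h2 : cost (l.map fun x => (c • x.1, x.2)) = ‖c‖ * cost l := by
      simp [cost, List.map_map, Function.comp_def, norm_smul, mul_assoc, List.sum_map_mul_left]
    rw [h1, ← h2]
    exact norm_le_cost _
  refine le_of_forall_pos_le_add fun ε hε => ?_
  obtain ⟨l, rfl, hl⟩ := exists_cost_lt u (ε := ε / (‖c‖ + 1)) (by positivity)
  refine (key l).trans ?_
  calc ‖c‖ * cost l ≤ ‖c‖ * (‖ofList l‖ + ε / (‖c‖ + 1)) := by gcongr
    _ = ‖c‖ * ‖ofList l‖ + ‖c‖ / (‖c‖ + 1) * ε := by ring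
    _ ≤ ‖c‖ * ‖ofList l‖ + 1 * ε := by
      gcongr
      rw [div_le_one (by positivity)]
      linarith
    _ = _ := by ring

noncomputable instance : SeminormedAddCommGroup (AlgProjectiveTensor A B) :=
  AddGroupSeminorm.toSeminormedAddCommGroup
    { toFun := fun u => ‖u‖
      map_zero' := le_antisymm (norm_le_cost []) (norm_nonneg' _)
      add_le' := norm_add_le'
      neg' := fun u => by
        have h : ∀ u : AlgProjectiveTensor A B, ‖-u‖ ≤ ‖u‖ := fun u => by
          have := norm_smul_le' (-1 : ℂ) u
          simpa using this
        exact le_antisymm (h u) (by simpa using h (-u)) }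

theorem norm_mul_le' (u v : AlgProjectiveTensor A B) : ‖u * v‖ ≤ ‖u‖ * ‖v‖ := by
  have hone : ∀ (a : A) (b : B) (m : List (A × B)),
      ‖tmul a b * ofList m‖ ≤ ‖a‖ * ‖b‖ * cost m := by
    intro a b m
    induction m with
    | nil => simp [ofList, cost]
    | cons x m ih =>
      have h1 : ofList (x :: m) = tmul x.1 x.2 + ofList m := by simp [ofList]
      have h2 : cost (x :: m) = ‖x.1‖ * ‖x.2‖ + cost m := by simp [cost]
      rw [h1, h2, mul_add, tmul_mul_tmul, mul_add]
      refine (norm_add_le _ _).trans (add_le_add ?_ ih)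
      have h3 := norm_le_cost [(a * x.1, b * x.2)]
      simp only [ofList, cost, List.map_cons, List.map_nil, List.sum_singleton] at h3
      refine h3.trans ?_
      calc ‖a * x.1‖ * ‖b * x.2‖ ≤ (‖a‖ * ‖x.1‖) * (‖b‖ * ‖x.2‖) := by
            gcongr <;> exact norm_mul_le _ _
        _ = _ := by ring
  have hlist : ∀ l m : List (A × B), ‖ofList l * ofList m‖ ≤ cost l * cost m := by
    intro l m
    induction l with
    | nil => simp [ofList, cost]
    | cons x l ih =>
      have h1 : ofList (x :: l) = tmul x.1 x.2 + ofList l := by simp [ofList]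
      have h2 : cost (x :: l) = ‖x.1‖ * ‖x.2‖ + cost l := by simp [cost]
      rw [h1, h2, add_mul, add_mul]
      exact (norm_add_le _ _).trans (add_le_add (hone _ _ _) ih)
  have hlim : Filter.Tendsto (fun ε : ℝ => (‖u‖ + ε) * (‖v‖ + ε)) (nhdsWithin 0 (Set.Ioi 0))
      (nhds (‖u‖ * ‖v‖)) := by
    have : Continuous (fun ε : ℝ => (‖u‖ + ε) * (‖v‖ + ε)) := by fun_prop
    have h := this.tendsto 0
    simp only [add_zero] at h
    exact h.mono_left nhdsWithin_le_nhds
  refine ge_of_tendsto hlim ?_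
  filter_upwards [self_mem_nhdsWithin] with ε hε
  obtain ⟨l, hl', hl⟩ := exists_cost_lt u hε
  obtain ⟨m, hm', hm⟩ := exists_cost_lt v hε
  have h := hlist l m
  rw [hl', hm'] at h
  exact h.trans (mul_le_mul hl.le hm.le (cost_nonneg m) ((cost_nonneg l).trans hl.le))

noncomputable instance : NonUnitalSeminormedRing (AlgProjectiveTensor A B) where
  __ := (inferInstance : SeminormedAddCommGroup (AlgProjectiveTensor A B))
  __ := (inferInstance : NonUnitalRing (AlgProjectiveTensor A B))
  norm_mul_le := norm_mul_le'

noncomputable instance : NormedSpace ℂ (AlgProjectiveTensor A B) where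
  norm_smul_le := norm_smul_le'

end AlgProjectiveTensor

/-- The projective tensor product `A ⊗^γ B`: the completion of `A ⊗ B` in the projective norm. -/
abbrev ProjectiveTensor : Type max v w := NormedRingCompletion (AlgProjectiveTensor A B)

end AlgProjectiveTensor

section Arens

variable {A : Type v} [NonUnitalNormedRing A] [NormedSpace ℂ A] [IsScalarTower ℂ A A]
  [SMulCommClass ℂ A A]

/-- The functional `ω_a = (L_a)^* ω`, that is `ω_a (b) = ω (a b)`, as a function of `a`. -/
noncomputable def leftTranslate (ω : StrongDual ℂ A) : A →L[ℂ] StrongDual ℂ A :=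
  (ContinuousLinearMap.compL ℂ A A ℂ ω) ∘L ContinuousLinearMap.mul ℂ A

/-- The functional `_aω = (R_a)^* ω`, that is `_aω (b) = ω (b a)`, as a function of `a`. -/
noncomputable def rightTranslate (ω : StrongDual ℂ A) : A →L[ℂ] StrongDual ℂ A :=
  (ContinuousLinearMap.compL ℂ A A ℂ ω) ∘L (ContinuousLinearMap.mul ℂ A).flip

/-- The functional `ω_f`, `ω_f (a) = f (_aω)`, for `f` in the bidual. -/
noncomputable def bidualLeft (ω : StrongDual ℂ A) (f : StrongDual ℂ (StrongDual ℂ A)) :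
    StrongDual ℂ A :=
  f ∘L rightTranslate ω

/-- The functional `_fω`, `_fω (a) = f (ω_a)`, for `f` in the bidual. -/
noncomputable def bidualRight (ω : StrongDual ℂ A) (f : StrongDual ℂ (StrongDual ℂ A)) :
    StrongDual ℂ A :=
  f ∘L leftTranslate ω

@[simp] theorem leftTranslate_apply (ω : StrongDual ℂ A) (a b : A) :
    leftTranslate ω a b = ω (a * b) := rfl

@[simp] theorem rightTranslate_apply (ω : StrongDual ℂ A) (a b : A) :
    rightTranslate ω a b = ω (b * a) := rfl

theorem norm_bidualLeft_le (ω : StrongDual ℂ A) (f : StrongDual ℂ (StrongDual ℂ A)) :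
    ‖bidualLeft ω f‖ ≤ ‖f‖ * ‖ω‖ := by
  refine ContinuousLinearMap.opNorm_le_bound _ (by positivity) fun a => ?_
  have h : ‖rightTranslate ω a‖ ≤ ‖ω‖ * ‖a‖ := by
    refine ContinuousLinearMap.opNorm_le_bound _ (by positivity) fun b => ?_
    calc ‖ω (b * a)‖ ≤ ‖ω‖ * (‖b‖ * ‖a‖) := ω.le_opNorm_of_le (norm_mul_le b a)
      _ = _ := by ring
  calc ‖f (rightTranslate ω a)‖ ≤ ‖f‖ * (‖ω‖ * ‖a‖) := f.le_opNorm_of_le h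
    _ = _ := by ring

theorem norm_bidualRight_le (ω : StrongDual ℂ A) (f : StrongDual ℂ (StrongDual ℂ A)) :
    ‖bidualRight ω f‖ ≤ ‖f‖ * ‖ω‖ := by
  refine ContinuousLinearMap.opNorm_le_bound _ (by positivity) fun a => ?_
  have h : ‖leftTranslate ω a‖ ≤ ‖ω‖ * ‖a‖ := by
    refine ContinuousLinearMap.opNorm_le_bound _ (by positivity) fun b => ?_
    calc ‖ω (a * b)‖ ≤ ‖ω‖ * (‖a‖ * ‖b‖) := ω.le_opNorm_of_le (norm_mul_le a b)
      _ = _ := by ring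
  calc ‖f (leftTranslate ω a)‖ ≤ ‖f‖ * (‖ω‖ * ‖a‖) := f.le_opNorm_of_le h
    _ = _ := by ring

/-- The first Arens product on the bidual, `(f □ g) (ω) = f (_gω)`. -/
noncomputable def arensBox (f g : StrongDual ℂ (StrongDual ℂ A)) :
    StrongDual ℂ (StrongDual ℂ A) :=
  LinearMap.mkContinuous
    { toFun := fun ω => f (bidualRight ω g)
      map_add' := fun ω η => by
        rw [← map_add]; congr 1; ext a
        simp [bidualRight, leftTranslate]
      map_smul' := fun c ω => by
        rw [RingHom.id_apply, ← map_smul]; congr 1; ext a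
        simp [bidualRight, leftTranslate] }
    (‖f‖ * ‖g‖) fun ω => by
      rw [mul_assoc]; exact f.le_opNorm_of_le (norm_bidualRight_le ω g)

/-- The second Arens product on the bidual, `(f ◇ g) (ω) = g (ω_f)`. -/
noncomputable def arensDiamond (f g : StrongDual ℂ (StrongDual ℂ A)) :
    StrongDual ℂ (StrongDual ℂ A) :=
  LinearMap.mkContinuous
    { toFun := fun ω => g (bidualLeft ω f)
      map_add' := fun ω η => by
        rw [← map_add]; congr 1; ext a
        simp [bidualLeft, rightTranslate]
      map_smul' := fun c ω => by
        rw [RingHom.id_apply, ← map_smul]; congr 1; ext a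
        simp [bidualLeft, rightTranslate] }
    (‖g‖ * ‖f‖) fun ω => by
      rw [mul_assoc]; exact g.le_opNorm_of_le (norm_bidualLeft_le ω f)

@[simp] theorem arensBox_apply (f g : StrongDual ℂ (StrongDual ℂ A)) (ω : StrongDual ℂ A) :
    arensBox f g ω = f (bidualRight ω g) := rfl

@[simp] theorem arensDiamond_apply (f g : StrongDual ℂ (StrongDual ℂ A)) (ω : StrongDual ℂ A) :
    arensDiamond f g ω = g (bidualLeft ω f) := rfl

variable (A) in
/-- A normed algebra is Arens regular if the two Arens products on its bidual coincide. -/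
def ArensRegular : Prop :=
  ∀ f g : StrongDual ℂ (StrongDual ℂ A), arensBox f g = arensDiamond f g

end Arens

end Schatten

/-! Arens regularity forces iterated limits to agree. If (a_n), (b_m) are bounded and f, g are
weak-* limits of them in the bidual along one ultrafilter, then (f □ g)(ω) is lim_n lim_m ω(a_n
b_m), while (f ◇ g)(ω) is lim_m lim_n ω(a_n b_m). A functional with ω(a_n b_m) = 1 for n ≤ m and 0
otherwise gives 1 and 0, so it refutes regularity (`not_arensRegular_of_step`).

To build ω, fix orthonormal sequences in H₁ and H₂ and let x_{nm}, y_{nm} be the matrix coefficients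
of x and y in them. Since p, q ≤ 2, the Hilbert-Schmidt norm is dominated by both Schatten norms
(`tsum_enorm_sq_le_schattenENorm`), so both arrays are square summable. By Cauchy-Schwarz the
entrywise product is absolutely summable, hence restricting the sum to n ≤ m costs nothing: ∑_{n ≤
m} x_{nm} y_{nm} is a bilinear form bounded by ‖x‖ ‖y‖ (`upperTerm_bound`). Bounded bilinear forms
are functionals on the projective tensor product (`ProjectiveTensor.exists_functional`).

With matrix units E_{ij}, put a_n = E_{n0} ⊗ E_{n0} and b_m = E_{0m} ⊗ E_{0m}. Both sequences lie in
the unit ball, and a_n b_m = E_{nm} ⊗ E_{nm}, on which ω takes the value 1 exactly when n ≤ m. -/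

namespace Schatten

open Filter Topology
open scoped ENNReal TensorProduct

/-! ### Iterated limits and the two Arens products -/

section DoubleLimit

/-- A bounded sequence in a normed space converges weak-* in the bidual along the hyperfilter. -/
theorem exists_bidual_tendsto {E : Type*} [NormedAddCommGroup E] [NormedSpace ℂ E] (x : ℕ → E)
    {C : ℝ} (hx : ∀ n, ‖x n‖ ≤ C) :
    ∃ f : StrongDual ℂ (StrongDual ℂ E),
      ∀ φ : StrongDual ℂ E, Tendsto (fun n => φ (x n)) (hyperfilter ℕ) (𝓝 (f φ)) := by
  let J : ℕ → WeakDual ℂ (StrongDual ℂ E) := fun n =>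
    StrongDual.toWeakDual (NormedSpace.inclusionInDoubleDual ℂ E (x n))
  -- Banach-Alaoglu: the image of the ultrafilter lives on a weak-* compact ball, so it converges,
  -- and a single limit serves all φ at once.
  have hK := WeakDual.isCompact_closedBall (𝕜 := ℂ) (0 : StrongDual ℂ (StrongDual ℂ E)) C
  obtain ⟨f, -, hf⟩ := hK.ultrafilter_le_nhds ((hyperfilter ℕ).map J) (by
    rw [le_principal_iff, Ultrafilter.mem_coe, Ultrafilter.mem_map]
    refine univ_mem' fun n => ?_
    exact mem_closedBall_zero_iff.mpr ((NormedSpace.double_dual_bound ℂ E (x n)).trans (hx n)))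
  exact ⟨WeakDual.toStrongDual f, fun φ =>
    ((WeakDual.eval_continuous φ).tendsto f).comp (show Tendsto J (hyperfilter ℕ) (𝓝 f) from hf)⟩

/-- If a functional separates the order of two bounded sequences, the algebra is not
Arens regular. -/
theorem not_arensRegular_of_step {A : Type*} [NonUnitalNormedRing A] [NormedSpace ℂ A]
    [IsScalarTower ℂ A A] [SMulCommClass ℂ A A] (ω : StrongDual ℂ A) (a b : ℕ → A) {C : ℝ}
    (ha : ∀ n, ‖a n‖ ≤ C) (hb : ∀ n, ‖b n‖ ≤ C)
    (hω : ∀ n m, ω (a n * b m) = if n ≤ m then 1 else 0) : ¬ ArensRegular A := by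
  intro hreg
  obtain ⟨f, hf⟩ := exists_bidual_tendsto a ha
  obtain ⟨g, hg⟩ := exists_bidual_tendsto b hb
  -- The ultrafilter contains every tail of ℕ, so limits along it depend only on eventual values.
  have hcof : ((hyperfilter ℕ : Ultrafilter ℕ) : Filter ℕ) ≤ atTop := by
    rw [← Nat.cofinite_eq_atTop]; exact hyperfilter_le_cofinite
  have h1 : ∀ n, g (leftTranslate ω (a n)) = 1 := fun n => by
    refine tendsto_nhds_unique (hg _) (tendsto_const_nhds.congr' ?_)
    filter_upwards [hcof (eventually_ge_atTop n)] with m hm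
    rw [leftTranslate_apply, hω, if_pos hm]
  have h0 : ∀ m, f (rightTranslate ω (b m)) = 0 := fun m => by
    refine tendsto_nhds_unique (hf _) (tendsto_const_nhds.congr' ?_)
    filter_upwards [hcof (eventually_gt_atTop m)] with n hn
    rw [rightTranslate_apply, hω, if_neg (not_le.mpr hn)]
  -- The limit in m sits inside: `bidualRight ω g` takes at `a n` the value `g (leftTranslate ω (a
  -- n))`, which is 1 for every n. For `arensDiamond` the limit in n sits inside instead and gives
  -- 0.
  have hbox : arensBox f g ω = 1 := by
    rw [arensBox_apply]
    exact tendsto_nhds_unique (hf _)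
      (tendsto_const_nhds.congr fun n => (h1 n).symm)
  have hdia : arensDiamond f g ω = 0 := by
    rw [arensDiamond_apply]
    exact tendsto_nhds_unique (hg _)
      (tendsto_const_nhds.congr fun m => (h0 m).symm)
  rw [hreg f g, hdia] at hbox
  exact zero_ne_one hbox

end DoubleLimit

/-! ### Comparison with the Hilbert-Schmidt norm; rank one operators -/

section HilbertSchmidt

variable {H : Type*} [NormedAddCommGroup H] [InnerProductSpace ℂ H] [CompleteSpace H]

/-- The Hilbert-Schmidt norm is dominated by the Schatten `p`-norm for `p ≤ 2`. -/
theorem tsum_enorm_sq_le_schattenENorm {ι : Type*} (c : HilbertBasis ι ℂ H) {p : ℝ}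
    (hp : p ∈ Set.Icc (1 : ℝ) 2) (T : H →L[ℂ] H) :
    ∑' i, ‖T (c i)‖ₑ ^ 2 ≤ schattenENorm p T ^ 2 := by
  have hp0 : 0 < p := by linarith [hp.1]
  rcases eq_or_ne (schattenENorm p T) ∞ with hT | hT
  · simp [hT]
  obtain ⟨κ, b, μ, h, h1, -, h3, -, h5⟩ := svd T (compact_of_schattenENorm p hp T hT)
  have hN : schattenENorm p T = (∑' i, (μ i : ℝ≥0∞) ^ p) ^ (1 / p) := by
    rw [schattenENorm, h5 p hp0]
  set N := schattenENorm p T with hNdef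
  have hNp : N ^ p = ∑' i, (μ i : ℝ≥0∞) ^ p := by
    rw [hN, ← ENNReal.rpow_mul, one_div_mul_cancel hp0.ne', ENNReal.rpow_one]
  -- Each singular value is at most N, so μ² = μ^p μ^(2-p) ≤ μ^p N^(2-p). Summing over i gives N^p
  -- N^(2-p) = N².
  have hμN : ∀ i, (μ i : ℝ≥0∞) ≤ N := fun i => by
    rw [hN, one_div, ENNReal.le_rpow_inv_iff hp0]
    exact ENNReal.le_tsum i
  -- Both exponents are nonnegative because 0 < p ≤ 2, so the splitting also holds at 0 and ∞.
  have hsq : ∀ x : ℝ≥0∞, x ^ 2 = x ^ p * x ^ (2 - p) := fun x => by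
    rw [← ENNReal.rpow_add_of_nonneg _ _ hp0.le (by linarith [hp.2]), add_sub_cancel,
      ENNReal.rpow_ofNat]
  -- Passing to the adjoint and back replaces the given basis `c` by the basis `b` of the singular
  -- value decomposition.
  rw [hs_swap c c T, ← hs_swap b c T, hsq N, hNp, ← ENNReal.tsum_mul_right]
  refine ENNReal.tsum_le_tsum fun i => ?_
  have h6 : ‖T (b i)‖ₑ ≤ μ i := by
    rw [h1, enorm_smul]
    have : ‖((μ i : ℝ) : ℂ)‖ₑ = μ i := by rw [← ofReal_norm]; simp
    rw [this]
    exact mul_le_of_le_one_right zero_le (h3 i)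
  calc ‖T (b i)‖ₑ ^ 2 ≤ (μ i : ℝ≥0∞) ^ 2 := by gcongr
    _ = (μ i : ℝ≥0∞) ^ p * (μ i : ℝ≥0∞) ^ (2 - p) := hsq _
    _ ≤ _ := by
      gcongr
      · linarith [hp.2]
      · exact hμN i

/-- Complete e to a Hilbert basis. Bessel's inequality bounds each column of coefficients by ‖T
e_m‖², and the sum of these over m is part of the full Hilbert-Schmidt sum. -/
theorem tsum_enorm_inner_sq_le_schattenENorm {e : ℕ → H} (he : Orthonormal ℂ e) {p : ℝ}
    (hp : p ∈ Set.Icc (1 : ℝ) 2) (T : H →L[ℂ] H) :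
    ∑' k : ℕ × ℕ, ‖inner ℂ (e k.1) (T (e k.2))‖ₑ ^ 2 ≤ schattenENorm p T ^ 2 := by
  obtain ⟨w, b, hw, hb⟩ := he.toSubtypeRange.exists_hilbertBasis_extension
  let j : ℕ → w := fun n => ⟨e n, hw ⟨n, rfl⟩⟩
  have hj : Function.Injective j := fun m n h =>
    he.linearIndependent.injective (congrArg Subtype.val h)
  have hbj : ∀ n, b (j n) = e n := fun n => by rw [hb]
  calc ∑' k : ℕ × ℕ, ‖inner ℂ (e k.1) (T (e k.2))‖ₑ ^ 2
      = ∑' m, ∑' n, ‖inner ℂ (b (j n)) (T (e m))‖ₑ ^ 2 := by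
        rw [ENNReal.tsum_prod (f := fun n m => ‖inner ℂ (e n) (T (e m))‖ₑ ^ 2),
          ENNReal.tsum_comm]
        simp_rw [hbj]
    _ ≤ ∑' m, ‖T (b (j m))‖ₑ ^ 2 := by
        refine ENNReal.tsum_le_tsum fun m => ?_
        rw [hbj, ← parseval b]
        exact ENNReal.tsum_comp_le_tsum_of_injective hj
          fun i => ‖inner ℂ (b i) (T (e m))‖ₑ ^ 2
    _ ≤ ∑' i, ‖T (b i)‖ₑ ^ 2 :=
        ENNReal.tsum_comp_le_tsum_of_injective hj fun i => ‖T (b i)‖ₑ ^ 2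
    _ ≤ _ := tsum_enorm_sq_le_schattenENorm b hp T

/-- The singular values are μ_i = |⟨b_i, v⟩| |⟨h_i, u⟩|. Cauchy-Schwarz, with Parseval for b and
Bessel for h, gives ∑ μ_i ≤ 1. Each μ_i is then at most 1, so μ_i^p ≤ μ_i, and no explicit absolute
value is needed. -/
theorem schattenENorm_rankOne_le {p : ℝ} (hp : 1 ≤ p) {u v : H} (hu : ‖u‖ₑ ≤ 1) (hv : ‖v‖ₑ ≤ 1) :
    schattenENorm p (InnerProductSpace.rankOne ℂ u v) ≤ 1 := by
  have hp0 : 0 < p := by linarith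
  -- The operator factors through the scalars ℂ.
  have hc : IsCompactOperator (InnerProductSpace.rankOne ℂ u v : H →L[ℂ] H) := by
    have h : IsCompactOperator (innerSL ℂ v) :=
      isCompactOperator_of_locallyCompactSpace_dom (innerSL ℂ v)
    exact h.clm_comp (ContinuousLinearMap.toSpanSingleton ℂ u)
  obtain ⟨κ, b, μ, h, -, h2, -, h4, h5⟩ := svd _ hc
  rw [schattenENorm, h5 p hp0]
  refine ENNReal.rpow_le_one ?_ (by positivity)
  have hμ : ∀ i, (μ i : ℝ≥0∞) = ‖inner ℂ (b i) v‖ₑ * ‖inner ℂ (h i) u‖ₑ := fun i => by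
    have h6 : ‖((μ i : ℝ) : ℂ)‖ₑ = μ i := by rw [← ofReal_norm]; simp
    rw [← h6, ← h2 i, InnerProductSpace.rankOne_apply, inner_smul_right, enorm_mul]
    congr 1
    rw [← ofReal_norm, ← ofReal_norm, norm_inner_symm]
  have hsum : ∑' i, (μ i : ℝ≥0∞) ≤ 1 := by
    simp_rw [hμ]
    refine tsum_mul_le_one _ _ ?_ ?_
    · rw [parseval]; exact pow_le_one₀ zero_le hv
    · exact (h4 u).trans (pow_le_one₀ zero_le hu)
  refine le_trans (ENNReal.tsum_le_tsum fun i => ?_) hsum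
  exact ENNReal.rpow_le_self_of_le_one ((ENNReal.le_tsum i).trans hsum) hp

end HilbertSchmidt

/-! ### Matrix coefficients and matrix units in the Schatten class -/

namespace SchattenClass

variable {H : Type*} [NormedAddCommGroup H] [InnerProductSpace ℂ H] [CompleteSpace H]
  {p : ℝ} [hp : Fact (p ∈ Set.Icc (1 : ℝ) 2)]

/-- The matrix coefficients of `T` in the family `e`. -/
noncomputable def coeff (e : ℕ → H) : SchattenClass p H →ₗ[ℂ] (ℕ × ℕ → ℂ) where
  toFun T k := inner ℂ (e k.1) (T.toCLM (e k.2))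
  map_add' S T := funext fun k => inner_add_right _ (S.toCLM (e k.2)) (T.toCLM (e k.2))
  map_smul' c T := funext fun k => inner_smul_right _ (T.toCLM (e k.2)) c

theorem coeff_apply (e : ℕ → H) (T : SchattenClass p H) (k : ℕ × ℕ) :
    coeff e T k = inner ℂ (e k.1) (T.toCLM (e k.2)) := rfl

theorem summable_coeff_sq {e : ℕ → H} (he : Orthonormal ℂ e) (T : SchattenClass p H) :
    Summable (fun k => ‖coeff e T k‖ ^ 2) ∧ ∑' k, ‖coeff e T k‖ ^ 2 ≤ ‖T‖ ^ 2 := by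
  have h := tsum_enorm_inner_sq_le_schattenENorm he hp.out T.toCLM
  have hfin := T.schattenENorm_ne_top
  have hne : ∑' k, ‖coeff e T k‖ₑ ^ 2 ≠ ∞ := ne_top_of_le_ne_top (by finiteness) h
  have heq : (fun k => ‖coeff e T k‖ ^ 2) = fun k => (‖coeff e T k‖ₑ ^ 2).toReal := by
    ext k; simp
  rw [heq]
  refine ⟨ENNReal.summable_toReal hne, ?_⟩
  rw [← ENNReal.tsum_toReal_eq (fun k => by finiteness), norm_def, ← ENNReal.toReal_pow]
  exact ENNReal.toReal_mono (by finiteness) h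

/-- The rank one operator `x ↦ ⟨v, x⟩ u` as an element of the Schatten class. -/
noncomputable def rankOne (u v : H) (hu : ‖u‖ = 1) (hv : ‖v‖ = 1) : SchattenClass p H :=
  ⟨InnerProductSpace.rankOne ℂ u v, (schattenENorm_rankOne_le hp.out.1
    (by rw [← ofReal_norm, hu]; simp) (by rw [← ofReal_norm, hv]; simp)).trans_lt
      ENNReal.one_lt_top⟩

theorem norm_rankOne_le {u v : H} (hu : ‖u‖ = 1) (hv : ‖v‖ = 1) :
    ‖(rankOne u v hu hv : SchattenClass p H)‖ ≤ 1 := by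
  have h := schattenENorm_rankOne_le (u := u) (v := v) hp.out.1
    (by rw [← ofReal_norm, hu]; simp) (by rw [← ofReal_norm, hv]; simp)
  exact ENNReal.toReal_mono ENNReal.one_ne_top h

/-- This is the matrix unit identity E_{n0} E_{0m} = E_{nm}: the common index 0 is contracted,
leaving an array with a single entry. -/
theorem coeff_rankOne_mul_rankOne {e : ℕ → H} (he : Orthonormal ℂ e) (n m : ℕ) (k : ℕ × ℕ) :
    coeff e ((rankOne (e n) (e 0) (he.1 n) (he.1 0) : SchattenClass p H) *
      rankOne (e 0) (e m) (he.1 0) (he.1 m)) k = if k = (n, m) then 1 else 0 := by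
  have h : ((rankOne (e n) (e 0) (he.1 n) (he.1 0) : SchattenClass p H) *
      rankOne (e 0) (e m) (he.1 0) (he.1 m)).toCLM (e k.2) =
      InnerProductSpace.rankOne ℂ (e n) (e 0) (InnerProductSpace.rankOne ℂ (e 0) (e m) (e k.2)) :=
    rfl
  rw [coeff_apply, h]
  simp only [InnerProductSpace.rankOne_apply, inner_smul_right, orthonormal_iff_ite.mp he]
  obtain ⟨i, j⟩ := k
  simp only [Prod.mk.injEq]
  by_cases hi : i = n <;> by_cases hj : j = m <;> simp [hi, hj, Ne.symm]

end SchattenClass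

/-! ### The upper triangular bilinear form -/

section UpperTriangular

variable {H₁ : Type*} [NormedAddCommGroup H₁] [InnerProductSpace ℂ H₁] [CompleteSpace H₁]
  {H₂ : Type*} [NormedAddCommGroup H₂] [InnerProductSpace ℂ H₂] [CompleteSpace H₂]
  {p q : ℝ} [Fact (p ∈ Set.Icc (1 : ℝ) 2)] [Fact (q ∈ Set.Icc (1 : ℝ) 2)]
  {e₁ : ℕ → H₁} {e₂ : ℕ → H₂}

open SchattenClass

/-- The `k`-th term of the upper triangular pairing. -/
noncomputable def upperTerm (e₁ : ℕ → H₁) (e₂ : ℕ → H₂) (x : SchattenClass p H₁)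
    (y : SchattenClass q H₂) (k : ℕ × ℕ) : ℂ :=
  (if k.1 ≤ k.2 then 1 else 0) * (coeff e₁ x k * coeff e₂ y k)

/-- Cauchy-Schwarz in ℓ²(ℕ × ℕ): the triangular cutoff has modulus at most 1, so it affects neither
absolute convergence nor the bound. -/
theorem upperTerm_bound (h₁ : Orthonormal ℂ e₁) (h₂ : Orthonormal ℂ e₂) (x : SchattenClass p H₁)
    (y : SchattenClass q H₂) :
    Summable (upperTerm e₁ e₂ x y) ∧ ‖∑' k, upperTerm e₁ e₂ x y k‖ ≤ ‖x‖ * ‖y‖ := by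
  obtain ⟨sx, bx⟩ := summable_coeff_sq h₁ x
  obtain ⟨sy, bY⟩ := summable_coeff_sq h₂ y
  obtain ⟨s, hs⟩ := Real.summable_and_inner_le_Lp_mul_Lq_tsum_of_nonneg Real.HolderConjugate.two_two
    (f := fun k => ‖coeff e₁ x k‖) (g := fun k => ‖coeff e₂ y k‖) (fun _ => norm_nonneg _)
    (fun _ => norm_nonneg _) (by simpa using sx) (by simpa using sy)
  simp only [Real.rpow_ofNat, ← Real.sqrt_eq_rpow] at hs
  have hle : ∀ k, ‖upperTerm e₁ e₂ x y k‖ ≤ ‖coeff e₁ x k‖ * ‖coeff e₂ y k‖ := fun k => by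
    rw [upperTerm, norm_mul, norm_mul]
    refine mul_le_of_le_one_left (by positivity) ?_
    split_ifs <;> simp
  refine ⟨Summable.of_norm_bounded s hle, (tsum_of_norm_bounded s.hasSum hle).trans
    (hs.trans ?_)⟩
  gcongr
  · exact Real.sqrt_le_iff.mpr ⟨norm_nonneg _, bx⟩
  · exact Real.sqrt_le_iff.mpr ⟨norm_nonneg _, bY⟩

/-- The bilinear form `(x, y) ↦ ∑_{n ≤ m} x_{nm} y_{nm}`. -/
noncomputable def upperForm (h₁ : Orthonormal ℂ e₁) (h₂ : Orthonormal ℂ e₂) :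
    SchattenClass p H₁ →ₗ[ℂ] SchattenClass q H₂ →ₗ[ℂ] ℂ :=
  LinearMap.mk₂ ℂ (fun x y => ∑' k, upperTerm e₁ e₂ x y k)
    -- Additivity of `tsum` uses summability of both series; homogeneity does not.
    (fun x x' y => by
      rw [← (upperTerm_bound h₁ h₂ x y).1.tsum_add (upperTerm_bound h₁ h₂ x' y).1]
      refine tsum_congr fun k => ?_
      simp only [upperTerm, map_add, Pi.add_apply]; ring)
    (fun c x y => by
      rw [smul_eq_mul, ← tsum_mul_left]
      refine tsum_congr fun k => ?_
      simp only [upperTerm, map_smul, Pi.smul_apply, smul_eq_mul]; ring)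
    (fun x y y' => by
      rw [← (upperTerm_bound h₁ h₂ x y).1.tsum_add (upperTerm_bound h₁ h₂ x y').1]
      refine tsum_congr fun k => ?_
      simp only [upperTerm, map_add, Pi.add_apply]; ring)
    (fun c x y => by
      rw [smul_eq_mul, ← tsum_mul_left]
      refine tsum_congr fun k => ?_
      simp only [upperTerm, map_smul, Pi.smul_apply, smul_eq_mul]; ring)

theorem upperForm_apply (h₁ : Orthonormal ℂ e₁) (h₂ : Orthonormal ℂ e₂) (x : SchattenClass p H₁)
    (y : SchattenClass q H₂) : upperForm h₁ h₂ x y = ∑' k, upperTerm e₁ e₂ x y k := rfl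

/-- The factor 1 plays the role of the constant `C` in `ProjectiveTensor.exists_functional`. -/
theorem norm_upperForm_le (h₁ : Orthonormal ℂ e₁) (h₂ : Orthonormal ℂ e₂) (x : SchattenClass p H₁)
    (y : SchattenClass q H₂) : ‖upperForm h₁ h₂ x y‖ ≤ 1 * (‖x‖ * ‖y‖) := by
  rw [one_mul]
  exact (upperTerm_bound h₁ h₂ x y).2

end UpperTriangular

/-! ### Functionals on the projective tensor product -/

namespace ProjectiveTensor

variable {A B : Type*} [NonUnitalNormedRing A] [NormedSpace ℂ A]
  [IsScalarTower ℂ A A] [SMulCommClass ℂ A A] [NonUnitalNormedRing B] [NormedSpace ℂ B]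
  [IsScalarTower ℂ B B] [SMulCommClass ℂ B B]

open AlgProjectiveTensor

theorem norm_of_tmul_le (a : A) (b : B) :
    ‖(NormedRingCompletion.of (tmul a b) : ProjectiveTensor A B)‖ ≤ ‖a‖ * ‖b‖ := by
  rw [NormedRingCompletion.norm_of]
  simpa [ofList, cost] using norm_le_cost [(a, b)]

/-- A bounded bilinear form on `A × B` extends to a functional on `A ⊗^γ B`. -/
theorem exists_functional (φ : A →ₗ[ℂ] B →ₗ[ℂ] ℂ) {C : ℝ}
    (hφ : ∀ a b, ‖φ a b‖ ≤ C * (‖a‖ * ‖b‖)) :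
    ∃ ω : StrongDual ℂ (ProjectiveTensor A B),
      ∀ a b, ω (NormedRingCompletion.of (tmul a b)) = φ a b := by
  let ψ : AlgProjectiveTensor A B →ₗ[ℂ] ℂ := (TensorProduct.lift φ : A ⊗[ℂ] B →ₗ[ℂ] ℂ)
  have hψ : ∀ a b, ψ (tmul a b) = φ a b := fun a b => TensorProduct.lift.tmul a b
  -- The bound holds for every representation of a tensor, hence for the infimum of their costs.
  have hlist : ∀ l : List (A × B), ‖ψ (ofList l)‖ ≤ C * cost l := by
    intro l
    induction l with
    | nil => simp [ofList, cost]
    | cons x l ih =>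
      have e1 : ofList (x :: l) = tmul x.1 x.2 + ofList l := by simp [ofList]
      have e2 : cost (x :: l) = ‖x.1‖ * ‖x.2‖ + cost l := by simp [cost]
      rw [e1, e2, map_add, hψ, mul_add]
      exact (norm_add_le _ _).trans (add_le_add (hφ _ _) ih)
  -- `C` is not assumed nonnegative; |C| makes the bound monotone in the cost.
  have hbound : ∀ u, ‖ψ u‖ ≤ |C| * ‖u‖ := by
    intro u
    have hlim : Tendsto (fun ε : ℝ => |C| * (‖u‖ + ε)) (𝓝[>] 0) (𝓝 (|C| * ‖u‖)) := by
      have : Continuous (fun ε : ℝ => |C| * (‖u‖ + ε)) := by fun_prop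
      have h := this.tendsto 0
      rw [add_zero] at h
      exact h.mono_left nhdsWithin_le_nhds
    refine ge_of_tendsto hlim ?_
    filter_upwards [self_mem_nhdsWithin] with ε hε
    obtain ⟨l, rfl, hl⟩ := exists_cost_lt u hε
    calc ‖ψ (ofList l)‖ ≤ C * cost l := hlist l
      _ ≤ |C| * cost l := mul_le_mul_of_nonneg_right (le_abs_self C) (cost_nonneg l)
      _ ≤ _ := by gcongr
  let Ψ : AlgProjectiveTensor A B →L[ℂ] ℂ := ψ.mkContinuous |C| hbound
  -- Norm preservation makes `of` uniformly inducing, which together with dense range suffices to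
  -- extend Ψ; injectivity of `of` is not required.
  have hiso : Isometry
      (NormedRingCompletion.of : AlgProjectiveTensor A B →L[ℂ] ProjectiveTensor A B) :=
    AddMonoidHomClass.isometry_of_norm _ NormedRingCompletion.norm_of
  refine ⟨Ψ.extend NormedRingCompletion.of, fun a b => ?_⟩
  rw [ContinuousLinearMap.extend_eq _ NormedRingCompletion.isDenseInducing_of.dense
    hiso.isUniformInducing]
  exact hψ a b

end ProjectiveTensor

/-! ### Orthonormal sequences and the conclusion -/

theorem exists_orthonormal_nat {H : Type*} [NormedAddCommGroup H] [InnerProductSpace ℂ H]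
    [CompleteSpace H] (h : ¬ FiniteDimensional ℂ H) : ∃ e : ℕ → H, Orthonormal ℂ e := by
  obtain ⟨w, b, -⟩ := exists_hilbertBasis ℂ H
  -- A Hilbert basis with finite index set would be a finite linear basis.
  have : Infinite w := by
    by_contra hw
    rw [not_infinite_iff_finite] at hw
    have := Fintype.ofFinite w
    exact h b.toOrthonormalBasis.toBasis.finiteDimensional_of_finite
  exact ⟨_, b.orthonormal.comp _ (Infinite.natEmbedding w).injective⟩

end Schatten

theorem mainTheorem4
    {H₁ : Type*} [NormedAddCommGroup H₁] [InnerProductSpace ℂ H₁] [CompleteSpace H₁]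
    {H₂ : Type*} [NormedAddCommGroup H₂] [InnerProductSpace ℂ H₂] [CompleteSpace H₂]
    (h₁ : ¬ FiniteDimensional ℂ H₁) (h₂ : ¬ FiniteDimensional ℂ H₂)
    (p q : ℝ) [Fact (p ∈ Set.Icc (1 : ℝ) 2)] [Fact (q ∈ Set.Icc (1 : ℝ) 2)] :
    ¬ Schatten.ArensRegular
      (Schatten.ProjectiveTensor (Schatten.SchattenClass p H₁) (Schatten.SchattenClass q H₂)) := by
  open Schatten SchattenClass AlgProjectiveTensor in
  obtain ⟨e₁, he₁⟩ := exists_orthonormal_nat h₁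
  obtain ⟨e₂, he₂⟩ := exists_orthonormal_nat h₂
  obtain ⟨ω, hω⟩ := ProjectiveTensor.exists_functional (upperForm (p := p) (q := q) he₁ he₂)
    (norm_upperForm_le he₁ he₂)
  -- Both sequences are special cases: j = 0 gives a_n and i = 0 gives b_m.
  have hnorm : ∀ i j : ℕ, ‖(NormedRingCompletion.of
      (tmul (rankOne (e₁ i) (e₁ j) (he₁.1 i) (he₁.1 j)) (rankOne (e₂ i) (e₂ j) (he₂.1 i) (he₂.1 j)))
        : ProjectiveTensor (SchattenClass p H₁) (SchattenClass q H₂))‖ ≤ 1 := fun i j =>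
    (ProjectiveTensor.norm_of_tmul_le _ _).trans
      (mul_le_one₀ (norm_rankOne_le _ _) (norm_nonneg _) (norm_rankOne_le _ _))
  refine not_arensRegular_of_step ω _ _ (fun n => hnorm n 0) (fun m => hnorm 0 m) fun n m => ?_
  rw [← NormedRingCompletion.of_mul, tmul_mul_tmul, hω, upperForm_apply]
  refine (tsum_congr fun k => congrArg₂ (fun s t : ℂ => (if k.1 ≤ k.2 then 1 else 0) * (s * t))
    (coeff_rankOne_mul_rankOne (p := p) he₁ n m k)
    (coeff_rankOne_mul_rankOne (p := q) he₂ n m k)).trans ?_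
  -- Both coefficient arrays are supported at (n, m), so the sum reduces to the cutoff there.
  rw [tsum_eq_single (n, m) fun k hk => by simp [hk]]
  simp
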